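/- Theorem 3.3. Let $(M,g_1)$ and $(B,g_2)$ be smooth finite-dimensional Riemannian manifolds without boundary. Let $B$ carry an almost contact metric structure $(\psi,\xi,\eta)$: a smooth $(1,1)$-tensor field $\psi$, vector field $\xi$ and $1$-form $\eta$ with $$\psi^2=-I+\eta\otimes\xi,\quad \psi\xi=0,\quad \eta\circ\psi=0,\quad \eta(\xi)=1,$$ $$g_2(\psi W,\psi Z)=g_2(W,Z)-\eta(W)\eta(Z),\quad g_2(\psi W,Z)=-g_2(W,\psi Z),\quad \eta(W)=g_2(W,\xi).$$ Assume that $B$ is trans-Sasakian of type $(\alpha,\beta)$, i.e. for smooth functions $\alpha,\beta$ on $B$, with $\nabla^B$ the Levi-Civita connection, $$(\nabla^B_W\psi)Z=\alpha\,(g_2(W,Z)\xi-\eta(Z)W)+\beta\,(g_2(\psi W,Z)\xi-\eta(Z)\psi W).$$ Let $\pi:M\to B$ be a Riemannian map, i.e. a smooth map with $g_2(\pi_*W,\pi_*Z)=g_1(W,Z)$ for $W,Z\in(\ker\pi_{*p})^\perp$, $p\in M$. Assume that $\pi$ is anti-invariant, $\psi(\mathrm{range}\,\pi_{*p})\subseteq(\mathrm{range}\,\pi_{*p})^\perp$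 for all $p$, and that the Reeb field is horizontal, $\xi_{\pi(p)}\in(\mathrm{range}\,\pi_{*p})^\perp$ for all $p$. Let $h:B\to\mathbb R$ be smooth, and let $\pi$ be a Clairaut map with $r=e^h$ in at least one of the following two senses: (a) there are an open set $U\supseteq\pi(M)$ and a smooth distribution $D$ on $U$ with $D_{\pi(p)}=\mathrm{range}\,\pi_{*p}$ for all $p\in M$, such that for every geodesic $\Omega$ of $B$ that is defined on an open interval and lies in $U$, the function $(r\circ\Omega)\sin\theta$ is constant, where $\theta(s)$ is the angle between $\dot\Omega(s)$ and its component $V(s)\in D^\perp$ (with $\theta=\pi/2$ if $V(s)=0$); (b) $\pi$ is umbilical with mean curvature vector field $H=-\nabla^Bh$: the second fundamental form $(\nabla\pi_*)(W,Z)=\nabla^\pi_W\pi_*Z-\pi_*(\nabla^M_WZ)$, where $\nabla^\pi$ is the pullback of $\nabla^B$ along $\pi$, satisfies $(\nabla\pi_*)(W,Z)=-g_1(W,Z)\,\nabla^Bh$ for $W,Z\in(\ker\pi_*)^\perp$. Then, at every $p\in M$, either $\dim(\mathrm{range}\,\pi_{*p})=1$ or $h$ is constant along $\psi(\mathrm{range}\,\pi_{*p})$,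 i.e. $dh_{\pi(p)}(\psi\,\pi_*W)=0$ for all $W\in T_pM$. If $M$ is connected, then either $\dim(\mathrm{range}\,\pi_*)=1$ on all of $M$, or $h$ is constant along $\psi(\mathrm{range}\,\pi_*)$ on all of $M$. -/

import Mathlib

open Bundle Set Filter
open scoped Manifold ContDiff Topology

noncomputable section

/-! ## Levi-Civita calculus in charts

Manifolds are smooth, finite dimensional and without boundary: they are modelled on `𝓘(ℝ, F)` for a
finite dimensional real vector space `F`. The Riemannian metric is Mathlib's
`RiemannianBundle` structure on the tangent bundle. -/

section LeviCivita

variable {F : Type*} [NormedAddCommGroup F] [NormedSpace ℝ F] [FiniteDimensional ℝ F]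
  {B : Type*} [TopologicalSpace B] [ChartedSpace F B] [IsManifold 𝓘(ℝ, F) ∞ B]

/-- Components of tangent vectors at `x` in the chart centred at `c` (for `x` in its domain). -/
def coordVec (c x : B) : TangentSpace 𝓘(ℝ, F) x →L[ℝ] F :=
  mvfderiv 𝓘(ℝ, F) (extChartAt 𝓘(ℝ, F) c) x

/-- The tangent vector at `x` with given components in the chart centred at `c`. -/
def ofCoordVec (c x : B) : F →L[ℝ] TangentSpace 𝓘(ℝ, F) x :=
  (coordVec c x).inverse

/-- A vector field is smooth on a set. -/
def SmoothFieldOn (X : ∀ x : B, TangentSpace 𝓘(ℝ, F) x) (U : Set B) : Prop :=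
  ContMDiffOn 𝓘(ℝ, F) (𝓘(ℝ, F).prod 𝓘(ℝ, F)) ∞ (fun x ↦ TotalSpace.mk' F x (X x)) U

variable [RiemannianBundle (fun x : B ↦ TangentSpace 𝓘(ℝ, F) x)]

/-- The metric in the chart centred at `c`: `g_y(u, v)` for `y` in the chart target. -/
def metricCoord (c : B) (y u v : F) : ℝ :=
  inner ℝ (ofCoordVec c ((extChartAt 𝓘(ℝ, F) c).symm y) u)
    (ofCoordVec c ((extChartAt 𝓘(ℝ, F) c).symm y) v)

/-- Christoffel symbols of the first kind,
`½ (∂_u g(v, w) + ∂_v g(u, w) - ∂_w g(u, v))`, in the chart centred at `c`. -/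
def christoffelFirst (c : B) (y u v w : F) : ℝ :=
  (fderiv ℝ (fun z ↦ metricCoord c z v w) y u + fderiv ℝ (fun z ↦ metricCoord c z u w) y v
    - fderiv ℝ (fun z ↦ metricCoord c z u v) y w) / 2

/-- The Gram matrix `(g_{ij})` in the chart centred at `c`. -/
def gramMatrix (c : B) (y : F) :
    Matrix (Fin (Module.finrank ℝ F)) (Fin (Module.finrank ℝ F)) ℝ :=
  Matrix.of fun i j ↦ metricCoord c y (Module.finBasis ℝ F i) (Module.finBasis ℝ F j)

/-- Christoffel symbols of the second kind: `Γ(u, v) = ∑_k (∑_l g^{kl} Γ_l(u, v)) e_k`. -/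
def christoffel (c : B) (y u v : F) : F :=
  ∑ k, (∑ l, (gramMatrix c y)⁻¹ k l * christoffelFirst c y u v (Module.finBasis ℝ F l)) •
    Module.finBasis ℝ F k

variable {E : Type*} [NormedAddCommGroup E] [NormedSpace ℝ E]
  {N : Type*} [TopologicalSpace N] [ChartedSpace E N]

/-- The covariant derivative `∇^f_w V` at `p` of a vector field `V` along a map `f : N → B`, for the
pullback of the Levi-Civita connection of `B`, computed in the chart of `B` centred at `c`:
`∂_w V^k + Γ^k_{ij} (df w)^i V^j`. The result does not depend on `c`, as long as `f p` lies in the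
domain of that chart. -/
def covDerivAlongIn (c : B) (f : N → B) (V : ∀ q : N, TangentSpace 𝓘(ℝ, F) (f q))
    (p : N) (w : TangentSpace 𝓘(ℝ, E) p) : TangentSpace 𝓘(ℝ, F) (f p) :=
  ofCoordVec c (f p)
    (mvfderiv 𝓘(ℝ, E) (fun q ↦ coordVec c (f q) (V q)) p w +
      christoffel c (extChartAt 𝓘(ℝ, F) c (f p))
        (coordVec c (f p) (mfderiv 𝓘(ℝ, E) 𝓘(ℝ, F) f p w)) (coordVec c (f p) (V p)))

/-- The pullback `∇^f_w V` of the Levi-Civita connection of `B` along `f : N → B`. -/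
def covDerivAlong (f : N → B) (V : ∀ q : N, TangentSpace 𝓘(ℝ, F) (f q))
    (p : N) (w : TangentSpace 𝓘(ℝ, E) p) : TangentSpace 𝓘(ℝ, F) (f p) :=
  covDerivAlongIn (f p) f V p w

/-- The Levi-Civita covariant derivative `∇_w X` of a vector field `X` on `B`. -/
def leviCivita (X : ∀ x : B, TangentSpace 𝓘(ℝ, F) x) (b : B) (w : TangentSpace 𝓘(ℝ, F) b) :
    TangentSpace 𝓘(ℝ, F) b :=
  covDerivAlong (fun x : B ↦ x) X b w

/-- The velocity of a curve. -/
def velocity (Ω : ℝ → B) (s : ℝ) : TangentSpace 𝓘(ℝ, F) (Ω s) :=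
  mfderiv 𝓘(ℝ, ℝ) 𝓘(ℝ, F) Ω s (1 : ℝ)

/-- `Ω` is a geodesic on the open interval `J`: it is `C²` there and `∇_Ω' Ω' = 0`. The equation may
be checked in any chart, since it does not depend on the chart. -/
def IsGeodesicOn (Ω : ℝ → B) (J : Set ℝ) : Prop :=
  ContMDiffOn 𝓘(ℝ, ℝ) 𝓘(ℝ, F) 2 Ω J ∧
  ∀ s ∈ J, ∃ c : B, Ω s ∈ (chartAt F c).source ∧
    covDerivAlongIn c Ω (velocity (F := F) Ω) s (1 : ℝ) = 0

end LeviCivita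

/-! ## Trans-Sasakian manifolds -/

section TransSasakian

variable (F : Type*) [NormedAddCommGroup F] [NormedSpace ℝ F] [FiniteDimensional ℝ F]
  (B : Type*) [TopologicalSpace B] [ChartedSpace F B] [IsManifold 𝓘(ℝ, F) ∞ B]
  [RiemannianBundle (fun x : B ↦ TangentSpace 𝓘(ℝ, F) x)]

/-- An almost contact metric structure `(ψ, ξ, η)` compatible with the metric of `B`. -/
structure AlmostContactMetric where
  /-- the `(1,1)`-tensor -/
  ψ : ∀ b : B, TangentSpace 𝓘(ℝ, F) b →L[ℝ] TangentSpace 𝓘(ℝ, F) b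
  /-- the Reeb vector field -/
  ξ : ∀ b : B, TangentSpace 𝓘(ℝ, F) b
  /-- the contact form -/
  η : ∀ b : B, TangentSpace 𝓘(ℝ, F) b →L[ℝ] ℝ
  smooth_ψ : ContMDiff 𝓘(ℝ, F) (𝓘(ℝ, F).prod 𝓘(ℝ, F →L[ℝ] F)) ∞
    (fun b ↦ TotalSpace.mk' (F →L[ℝ] F)
      (E := fun b : B ↦ TangentSpace 𝓘(ℝ, F) b →L[ℝ] TangentSpace 𝓘(ℝ, F) b) b (ψ b))
  smooth_ξ : SmoothFieldOn ξ univ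
  smooth_η : ContMDiff 𝓘(ℝ, F) (𝓘(ℝ, F).prod 𝓘(ℝ, F →L[ℝ] ℝ)) ∞
    (fun b ↦ TotalSpace.mk' (F →L[ℝ] ℝ)
      (E := fun b : B ↦ TangentSpace 𝓘(ℝ, F) b →L[ℝ] Trivial B ℝ b) b (η b))
  ψ_ψ : ∀ b v, ψ b (ψ b v) = -v + η b v • ξ b
  ψ_ξ : ∀ b, ψ b (ξ b) = 0
  η_ψ : ∀ b v, η b (ψ b v) = 0
  η_ξ : ∀ b, η b (ξ b) = 1
  inner_ψ_ψ : ∀ b v w, inner ℝ (ψ b v) (ψ b w) = inner ℝ v w - η b v * η b w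
  inner_ψ : ∀ b v w, inner ℝ (ψ b v) w = -inner ℝ v (ψ b w)
  η_eq : ∀ b v, η b v = inner ℝ v (ξ b)

variable {F B}

/-- `B` is trans-Sasakian of type `(α, β)`:
`(∇_W ψ)Z = α (g(W,Z) ξ - η(Z) W) + β (g(ψW,Z) ξ - η(Z) ψW)` with smooth `α`, `β`,
where `(∇_W ψ)Z = ∇_W(ψZ) - ψ(∇_W Z)` and `Z` runs over the local smooth vector fields. -/
def AlmostContactMetric.IsTransSasakian (S : AlmostContactMetric F B) (α β : B → ℝ) : Prop :=
  ContMDiff 𝓘(ℝ, F) 𝓘(ℝ, ℝ) ∞ α ∧ ContMDiff 𝓘(ℝ, F) 𝓘(ℝ, ℝ) ∞ β ∧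
  ∀ (U : Set B) (Z : ∀ b : B, TangentSpace 𝓘(ℝ, F) b), IsOpen U → SmoothFieldOn Z U →
    ∀ b ∈ U, ∀ w : TangentSpace 𝓘(ℝ, F) b,
      leviCivita (fun x ↦ S.ψ x (Z x)) b w - S.ψ b (leviCivita Z b w) =
        α b • ((inner ℝ w (Z b) : ℝ) • S.ξ b - S.η b (Z b) • w) +
        β b • ((inner ℝ (S.ψ b w) (Z b) : ℝ) • S.ξ b - S.η b (Z b) • S.ψ b w)

end TransSasakian

/-! ## Riemannian maps and the Clairaut condition -/

section RiemannianMaps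

variable {E : Type*} [NormedAddCommGroup E] [NormedSpace ℝ E] [FiniteDimensional ℝ E]
  {M : Type*} [TopologicalSpace M] [ChartedSpace E M] [IsManifold 𝓘(ℝ, E) ∞ M]
  [RiemannianBundle (fun x : M ↦ TangentSpace 𝓘(ℝ, E) x)]
  {F : Type*} [NormedAddCommGroup F] [NormedSpace ℝ F] [FiniteDimensional ℝ F]
  {B : Type*} [TopologicalSpace B] [ChartedSpace F B] [IsManifold 𝓘(ℝ, F) ∞ B]
  [RiemannianBundle (fun x : B ↦ TangentSpace 𝓘(ℝ, F) x)]

/-- The differential `f_* : T_p M → T_{f p} B`. -/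
def pushforward (f : M → B) (p : M) :
    TangentSpace 𝓘(ℝ, E) p →L[ℝ] TangentSpace 𝓘(ℝ, F) (f p) :=
  mfderiv 𝓘(ℝ, E) 𝓘(ℝ, F) f p

/-- The subspace `range f_{*p}` of `T_{f p} B`. -/
def rangeAt (f : M → B) (p : M) : Submodule ℝ (TangentSpace 𝓘(ℝ, F) (f p)) :=
  (pushforward (E := E) (F := F) f p).toLinearMap.range

/-- The horizontal space `(ker f_{*p})^⊥` of `T_p M`. -/
def horizontalAt (f : M → B) (p : M) : Submodule ℝ (TangentSpace 𝓘(ℝ, E) p) :=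
  (pushforward (E := E) (F := F) f p).toLinearMap.kerᗮ

/-- A smooth map is a Riemannian map if `f_*` is isometric on the horizontal spaces. -/
def IsRiemannianMap (f : M → B) : Prop :=
  ContMDiff 𝓘(ℝ, E) 𝓘(ℝ, F) ∞ f ∧
  ∀ p, ∀ w ∈ horizontalAt (E := E) (F := F) f p, ∀ z ∈ horizontalAt (E := E) (F := F) f p,
    inner ℝ (pushforward (E := E) (F := F) f p w) (pushforward (E := E) (F := F) f p z) =
      (inner ℝ w z : ℝ)

/-- `ψ (range f_{*p}) ⊆ (range f_{*p})^⊥` for all `p`. -/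
def IsAntiInvariant (S : AlmostContactMetric F B) (f : M → B) : Prop :=
  ∀ p, ∀ v ∈ rangeAt (E := E) (F := F) f p, S.ψ (f p) v ∈ (rangeAt (E := E) (F := F) f p)ᗮ

/-- The Reeb vector field is horizontal: `ξ ∈ (range f_{*p})^⊥` for all `p`. -/
def HasHorizontalReeb (S : AlmostContactMetric F B) (f : M → B) : Prop :=
  ∀ p, S.ξ (f p) ∈ (rangeAt (E := E) (F := F) f p)ᗮ

/-- The second fundamental form `(∇f_*)(w, z) = ∇^f_w (f_* Z) - f_* (∇_w Z)` at `p`. It is tensorial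
in `Z`; here `Z` is Mathlib's standard local extension of `z` to a vector field smooth near `p`. -/
def secondFundamentalForm (f : M → B) (p : M) (w z : TangentSpace 𝓘(ℝ, E) p) :
    TangentSpace 𝓘(ℝ, F) (f p) :=
  covDerivAlong f (fun q ↦ pushforward (E := E) (F := F) f q (FiberBundle.extend E z q)) p w -
    pushforward (E := E) (F := F) f p (leviCivita (FiberBundle.extend E z) p w)

/-- `D` is a smooth distribution on the open set `U`: near every point of `U` it is spanned by
linearly independent smooth vector fields. -/
def IsSmoothDistributionOn (D : ∀ b : B, Submodule ℝ (TangentSpace 𝓘(ℝ, F) b)) (U : Set B) :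
    Prop :=
  ∀ b ∈ U, ∃ O : Set B, IsOpen O ∧ b ∈ O ∧
    ∃ (k : ℕ) (X : Fin k → ∀ x : B, TangentSpace 𝓘(ℝ, F) x),
      (∀ i, SmoothFieldOn (X i) O) ∧
      ∀ x ∈ O, LinearIndependent ℝ (fun i ↦ X i x) ∧ Submodule.span ℝ (range fun i ↦ X i x) = D x

/-- Clairaut condition with girth function `r`, in terms of geodesics. The subspaces `range f_*`
extend to a smooth distribution `D` on an open set `U` that contains the image of `f`, and for every
geodesic `Ω` in `U`, with components `X ∈ D` and `V ∈ D^⊥` of its velocity, `(r ∘ Ω) sin θ` is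
constant, where `θ` is the angle between the velocity and `V`
(Mathlib's angle with a zero vector is `π / 2`, which is the right value when `V = 0`). -/
def IsClairautMap (f : M → B) (r : B → ℝ) : Prop :=
  (∀ b, 0 < r b) ∧
  ∃ (U : Set B) (D : ∀ b : B, Submodule ℝ (TangentSpace 𝓘(ℝ, F) b)),
    IsOpen U ∧ (∀ p, f p ∈ U) ∧ IsSmoothDistributionOn D U ∧
    (∀ p, D (f p) = rangeAt (E := E) (F := F) f p) ∧
    ∀ (Ω : ℝ → B) (J : Set ℝ), IsOpen J → J.OrdConnected → MapsTo Ω J U →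
      IsGeodesicOn (F := F) Ω J →
      ∃ C : ℝ, ∀ s ∈ J, ∀ X ∈ D (Ω s), ∀ V ∈ (D (Ω s))ᗮ, velocity (F := F) Ω s = X + V →
        r (Ω s) * Real.sin (InnerProductGeometry.angle (velocity (F := F) Ω s) V) = C

/-- Clairaut condition with `r = e^h`, in terms of the second fundamental form: `f` is umbilical with
mean curvature vector `H = -∇h`, that is `(∇f_*)(w, z) = -g₁(w, z) ∇h` for horizontal `w`, `z`. The
gradient is expressed by `g₂(∇h, v) = dh(v)`. -/
def IsClairautUmbilical (f : M → B) (h : B → ℝ) : Prop :=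
  ∀ p, ∀ w ∈ horizontalAt (E := E) (F := F) f p, ∀ z ∈ horizontalAt (E := E) (F := F) f p,
    ∀ v : TangentSpace 𝓘(ℝ, F) (f p),
      inner ℝ (secondFundamentalForm (E := E) (F := F) f p w z) v =
        -(inner ℝ w z * mvfderiv 𝓘(ℝ, F) h (f p) v)

/-- `h` is constant along `ψ (range f_{*p})`: `dh` vanishes on this subspace of `T_{f p} B`. -/
def IsConstantAlongAt (S : AlmostContactMetric F B) (f : M → B) (h : B → ℝ) (p : M) : Prop :=
  ∀ v ∈ rangeAt (E := E) (F := F) f p, mvfderiv 𝓘(ℝ, F) h (f p) (S.ψ (f p) v) = 0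

end RiemannianMaps

end

/-! Write W, Z, X for vectors of range π_*, and ∇ for the pullback connection along π. Two facts
about the Hessian ∇_w(π_*Z), paired with normal vectors u ⊥ range π_*, carry the theorem.

Symmetry (`bilin_flatHessian_symm`, `metricForm_hessianCoord_symm`). By anti-invariance g₂(ψπ_*Z,
π_*X) vanishes identically; differentiate it along w. The term with ∇ψ drops out: η vanishes on the
range, so the trans-Sasakian formula leaves a multiple of ξ, which is normal to the range. Since ψ
is skew, g₂(∇_w π_*Z, ψX) = g₂(∇_w π_*X, ψZ).

Clairaut (`metricForm_hessianCoord_of_isClairautMap`). Both senses of the condition give g₂(∇_w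
π_*Z, u) = -g₂(W, Z) dh(u) for horizontal w, z and u normal to the range. In the umbilical sense
this is immediate, because π_*∇Z lies in the range. In the geodesic sense, constancy of r sin θ says
|X|² = C² e^{-2h} |Ω'|² for the D-component X of the velocity. A section Y of D satisfies 2g₂(Y, Ω')
- |Y|² ≤ |X|², with equality where Y = X, so the difference of the two sides has a local minimum
there and its derivative is zero. This needs no derivative of the projection onto D. The geodesics
leaving with velocities W + u and W - u together isolate g₂(∇_W Y, u) = -|W|² dh(u); polarization
gives the rest.

Together: g₂(W, Z) dh(ψX) = g₂(W, X) dh(ψZ). If the rank is at least two, choose W = Z ≠ 0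
orthogonal to X to get dh(ψX) = 0; in rank zero there is nothing to prove
(`eq_zero_of_inner_mul_eq`). On a connected M one alternative holds globally because the rank of a
Riemannian map is locally constant (`isLocallyConstant_finrank_rangeAt`). -/

noncomputable section

set_option linter.unusedSectionVars false
set_option maxSynthPendingDepth 3

/-! ### Components of vectors, fields and the metric in a chart. -/

section Charts

variable {F : Type*} [NormedAddCommGroup F] [NormedSpace ℝ F] [FiniteDimensional ℝ F]
  {B : Type*} [TopologicalSpace B] [ChartedSpace F B] [IsManifold 𝓘(ℝ, F) ∞ B]

lemma coordVec_eq_continuousLinearMapAt {c x : B} (hx : x ∈ (chartAt F c).source) :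
    coordVec c x =
      (trivializationAt F (TangentSpace 𝓘(ℝ, F)) c).continuousLinearMapAt ℝ x := by
  rw [TangentBundle.continuousLinearMapAt_trivializationAt hx]
  rfl

lemma snd_trivializationAt {c x : B} (hx : x ∈ (chartAt F c).source)
    (v : TangentSpace 𝓘(ℝ, F) x) :
    (trivializationAt F (TangentSpace 𝓘(ℝ, F)) c ⟨x, v⟩).2 = coordVec c x v := by
  rw [coordVec_eq_continuousLinearMapAt hx, Trivialization.continuousLinearMapAt_apply,
    Trivialization.coe_linearMapAt_of_mem _ (by simpa using hx)]

lemma ofCoordVec_eq_symmL {c x : B} (hx : x ∈ (chartAt F c).source) :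
    ofCoordVec c x = (trivializationAt F (TangentSpace 𝓘(ℝ, F)) c).symmL ℝ x := by
  have hx' : x ∈ (trivializationAt F (TangentSpace 𝓘(ℝ, F)) c).baseSet := by simpa using hx
  unfold ofCoordVec
  rw [coordVec_eq_continuousLinearMapAt hx]
  refine ContinuousLinearMap.inverse_eq ?_ ?_
  · ext v; exact Trivialization.continuousLinearMapAt_symmL _ hx' v
  · ext v; exact Trivialization.symmL_continuousLinearMapAt _ hx' v

lemma coordVec_ofCoordVec {c x : B} (hx : x ∈ (chartAt F c).source) (u : F) :
    coordVec c x (ofCoordVec c x u) = u := by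
  have hx' : x ∈ (trivializationAt F (TangentSpace 𝓘(ℝ, F)) c).baseSet := by simpa using hx
  rw [ofCoordVec_eq_symmL hx, coordVec_eq_continuousLinearMapAt hx,
    Trivialization.continuousLinearMapAt_symmL _ hx']

lemma ofCoordVec_coordVec {c x : B} (hx : x ∈ (chartAt F c).source)
    (v : TangentSpace 𝓘(ℝ, F) x) : ofCoordVec c x (coordVec c x v) = v := by
  have hx' : x ∈ (trivializationAt F (TangentSpace 𝓘(ℝ, F)) c).baseSet := by simpa using hx
  rw [ofCoordVec_eq_symmL hx, coordVec_eq_continuousLinearMapAt hx,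
    Trivialization.symmL_continuousLinearMapAt _ hx']

lemma smoothFieldOn_ofCoordVec (c : B) (u : F) :
    SmoothFieldOn (fun x ↦ ofCoordVec c x u) (chartAt F c).source := by
  have hb : (trivializationAt F (TangentSpace 𝓘(ℝ, F)) c).baseSet = (chartAt F c).source := by simp
  unfold SmoothFieldOn
  rw [← hb, Trivialization.contMDiffOn_section_baseSet_iff]
  refine (contMDiffOn_const (c := u)).congr fun x hx ↦ ?_
  rw [snd_trivializationAt (hb ▸ hx), coordVec_ofCoordVec (hb ▸ hx)]

lemma SmoothFieldOn.contDiffAt_coordVec {X : ∀ x : B, TangentSpace 𝓘(ℝ, F) x} {U : Set B}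
    (hX : SmoothFieldOn X U) (hU : IsOpen U) {c : B} {y : F}
    (hy : y ∈ (extChartAt 𝓘(ℝ, F) c).target) (hyU : (extChartAt 𝓘(ℝ, F) c).symm y ∈ U) :
    ContDiffAt ℝ ∞ (fun z ↦ coordVec c ((extChartAt 𝓘(ℝ, F) c).symm z)
      (X ((extChartAt 𝓘(ℝ, F) c).symm z))) y := by
  have hs : (extChartAt 𝓘(ℝ, F) c).symm y ∈ (chartAt F c).source := by
    simpa using (extChartAt 𝓘(ℝ, F) c).map_target hy
  have h1 := (hX _ hyU).contMDiffAt (hU.mem_nhds hyU)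
  rw [(trivializationAt F (TangentSpace 𝓘(ℝ, F)) c).contMDiffAt_section_iff (by simpa using hs)]
    at h1
  have h2 : ContMDiffAt 𝓘(ℝ, F) 𝓘(ℝ, F) ∞ (extChartAt 𝓘(ℝ, F) c).symm y :=
    ((contMDiffOn_extChartAt_symm c) y hy).contMDiffAt
      ((isOpen_extChartAt_target c).mem_nhds hy)
  have h3 := (ContMDiffAt.comp y h1 h2).contDiffAt
  refine h3.congr_of_eventuallyEq ?_
  filter_upwards [(isOpen_extChartAt_target c).mem_nhds hy] with z hz
  have hs : (extChartAt 𝓘(ℝ, F) c).symm z ∈ (chartAt F c).source := by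
    simpa using (extChartAt 𝓘(ℝ, F) c).map_target hz
  exact (snd_trivializationAt hs _).symm

variable [RiemannianBundle (fun x : B ↦ TangentSpace 𝓘(ℝ, F) x)]

/-- The metric in a chart, as a continuous bilinear form. -/
def metricForm (c : B) (y : F) : F →L[ℝ] F →L[ℝ] ℝ :=
  LinearMap.toContinuousLinearMap
    ((LinearMap.toContinuousLinearMap : (F →ₗ[ℝ] ℝ) ≃ₗ[ℝ] (F →L[ℝ] ℝ)).toLinearMap ∘ₗ
      LinearMap.mk₂ ℝ (metricCoord c y)
        (fun _ _ _ ↦ by unfold metricCoord; rw [map_add]; exact inner_add_left _ _ _)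
        (fun _ _ _ ↦ by unfold metricCoord; rw [map_smul]; exact real_inner_smul_left _ _ _)
        (fun _ _ _ ↦ by unfold metricCoord; rw [map_add]; exact inner_add_right _ _ _)
        (fun _ _ _ ↦ by unfold metricCoord; rw [map_smul]; exact real_inner_smul_right _ _ _))

lemma metricForm_apply (c : B) (y u v : F) : metricForm c y u v = metricCoord c y u v := rfl

lemma metricForm_symm (c : B) (y u v : F) : metricForm c y u v = metricForm c y v u := by
  simp only [metricForm_apply, metricCoord]
  exact real_inner_comm _ _

lemma inner_eq_metricForm {c x : B} (hx : x ∈ (chartAt F c).source)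
    (v w : TangentSpace 𝓘(ℝ, F) x) :
    inner ℝ v w =
      metricForm c (extChartAt 𝓘(ℝ, F) c x) (coordVec c x v) (coordVec c x w) := by
  have hx' : (extChartAt 𝓘(ℝ, F) c).symm (extChartAt 𝓘(ℝ, F) c x) = x :=
    (extChartAt 𝓘(ℝ, F) c).left_inv (by simpa using hx)
  rw [metricForm_apply, metricCoord, hx', ofCoordVec_coordVec hx, ofCoordVec_coordVec hx]

lemma metricForm_self_pos {c : B} {y : F} (hy : y ∈ (extChartAt 𝓘(ℝ, F) c).target) {u : F}
    (hu : u ≠ 0) : 0 < metricForm c y u u := by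
  have hs : (extChartAt 𝓘(ℝ, F) c).symm y ∈ (chartAt F c).source := by
    simpa using (extChartAt 𝓘(ℝ, F) c).map_target hy
  rw [metricForm_apply, metricCoord, real_inner_self_eq_norm_sq]
  have : ofCoordVec c ((extChartAt 𝓘(ℝ, F) c).symm y) u ≠ 0 := fun h0 ↦ hu <| by
    rw [← coordVec_ofCoordVec hs u, h0, map_zero]
  positivity

variable [IsContMDiffRiemannianBundle 𝓘(ℝ, F) ∞ F (fun x : B ↦ TangentSpace 𝓘(ℝ, F) x)]

/-- In finite dimension, smoothness of a bilinear-form-valued map can be tested on fixed vectors;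
fields with constant components are smooth, and so are their inner products. -/
lemma contDiffOn_metricForm (c : B) :
    ContDiffOn ℝ ∞ (metricForm c) (extChartAt 𝓘(ℝ, F) c).target := by
  refine contDiffOn_clm_apply.2 fun u ↦ contDiffOn_clm_apply.2 fun v ↦ ?_
  have h := ContMDiffOn.inner_bundle (F := F) (E := fun x : B ↦ TangentSpace 𝓘(ℝ, F) x)
    (b := fun x : B ↦ x) (v := fun x ↦ ofCoordVec c x u) (w := fun x ↦ ofCoordVec c x v)
    (smoothFieldOn_ofCoordVec c u) (smoothFieldOn_ofCoordVec c v)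
  have h2 := h.comp (contMDiffOn_extChartAt_symm c) fun z hz ↦ by
    simpa using (extChartAt 𝓘(ℝ, F) c).map_target hz
  exact h2.contDiffOn

end Charts

/-! ### Smooth dependence of the inverse matrix on a parameter. -/

section MatrixSmoothness

variable {G : Type*} [NormedAddCommGroup G] [NormedSpace ℝ G] {n : ℕ} {k : WithTop ℕ∞}
  {A : G → Matrix (Fin n) (Fin n) ℝ} {x : G}

lemma ContDiffAt.matrix_det (hA : ∀ i j, ContDiffAt ℝ k (fun y ↦ A y i j) x) :
    ContDiffAt ℝ k (fun y ↦ (A y).det) x := by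
  simp only [Matrix.det_apply]
  refine ContDiffAt.sum fun σ _ ↦ ContDiffAt.const_smul _ ?_
  exact contDiffAt_prod fun i _ ↦ hA _ _

/-- Cramer's rule: the entries are cofactors, polynomial in the entries of `A`, divided by a
nonvanishing determinant. -/
lemma ContDiffAt.matrix_inv (hA : ∀ i j, ContDiffAt ℝ k (fun y ↦ A y i j) x)
    (hx : IsUnit (A x)) (i j : Fin n) : ContDiffAt ℝ k (fun y ↦ (A y)⁻¹ i j) x := by
  simp only [Matrix.inv_def, Matrix.smul_apply, Ring.inverse_eq_inv', smul_eq_mul,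
    Matrix.adjugate_apply]
  refine (ContDiffAt.inv (ContDiffAt.matrix_det hA)
    ((Matrix.isUnit_iff_isUnit_det _).1 hx).ne_zero).mul (ContDiffAt.matrix_det fun a b ↦ ?_)
  by_cases h : a = j
  · subst h
    simpa using contDiffAt_const
  · simpa [Matrix.updateRow_ne h] using hA a b

end MatrixSmoothness

/-! ### Levi-Civita calculus for a metric on an open subset of a vector space -/

section FlatMetric

variable {F : Type*} [NormedAddCommGroup F] [NormedSpace ℝ F]

lemma fderiv_bilin_apply {G : F → F →L[ℝ] F →L[ℝ] ℝ} {y : F}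
    (hG : DifferentiableAt ℝ G y) (a v w : F) :
    fderiv ℝ (fun z ↦ G z v w) y a = fderiv ℝ G y a v w := by
  have h := (hG.hasFDerivAt.clm_apply (hasFDerivAt_const v y)).clm_apply (hasFDerivAt_const w y)
  rw [h.fderiv]
  simp

lemma fderiv_bilin_symm {G : F → F →L[ℝ] F →L[ℝ] ℝ} {y : F}
    (hG : DifferentiableAt ℝ G y) (hs : ∀ y v w, G y v w = G y w v) (a v w : F) :
    fderiv ℝ G y a v w = fderiv ℝ G y a w v := by
  rw [← fderiv_bilin_apply hG, ← fderiv_bilin_apply hG]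
  simp only [hs _ v w]

/-- The Christoffel symbols of the first kind of the metric `G`. -/
def flatChristoffelFirst (G : F → F →L[ℝ] F →L[ℝ] ℝ) (y u v w : F) : ℝ :=
  (fderiv ℝ G y u v w + fderiv ℝ G y v u w - fderiv ℝ G y w u v) / 2

variable [FiniteDimensional ℝ F]

/-- The Gram matrix of the bilinear form `G`. -/
def flatGram (G : F →L[ℝ] F →L[ℝ] ℝ) :
    Matrix (Fin (Module.finrank ℝ F)) (Fin (Module.finrank ℝ F)) ℝ :=
  Matrix.of fun i j ↦ G (Module.finBasis ℝ F i) (Module.finBasis ℝ F j)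

/-- The Christoffel symbols of the second kind of the metric `G`. -/
def flatChristoffel (G : F → F →L[ℝ] F →L[ℝ] ℝ) (y u v : F) : F :=
  ∑ k, (∑ l, (flatGram (G y))⁻¹ k l * flatChristoffelFirst G y u v (Module.finBasis ℝ F l)) •
    Module.finBasis ℝ F k

/-- A vector in the kernel of the Gram matrix is the coordinate vector of some X orthogonal to the
whole basis, hence to itself; positivity forces X = 0. -/
lemma isUnit_flatGram {G : F →L[ℝ] F →L[ℝ] ℝ} (hs : ∀ v w, G v w = G w v)
    (hpos : ∀ u, u ≠ 0 → 0 < G u u) : IsUnit (flatGram G) := by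
  rw [← Matrix.mulVec_injective_iff_isUnit]
  have key : ∀ x, (flatGram G).mulVec x = 0 → x = 0 := by
    intro x hx
    set X : F := ∑ i, x i • Module.finBasis ℝ F i with hX
    have h1 : ∀ j, G (Module.finBasis ℝ F j) X = 0 := fun j ↦ by
      have := congrFun hx j
      simp only [Matrix.mulVec, dotProduct, flatGram, Matrix.of_apply, Pi.zero_apply] at this
      rw [hX, map_sum, ← this]
      refine Finset.sum_congr rfl fun i _ ↦ ?_
      rw [map_smul, smul_eq_mul, mul_comm]
    have h2 : G X X = 0 := by
      conv_lhs => arg 2; rw [hX]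
      rw [map_sum]
      exact Finset.sum_eq_zero fun i _ ↦ by
        rw [map_smul, hs, h1, smul_zero]
    have h3 : X = 0 := by
      by_contra hne
      exact (hpos X hne).ne' h2
    exact funext fun i ↦
      (Fintype.linearIndependent_iff.1 (Module.finBasis ℝ F).linearIndependent) x (hX ▸ h3) i
  intro x x' h
  exact sub_eq_zero.1 (key _ (by rw [Matrix.mulVec_sub]; exact sub_eq_zero.2 h))

variable {G : F → F →L[ℝ] F →L[ℝ] ℝ}

/-- Lowering the index undoes multiplication by the inverse Gram matrix. Later computations use this
characterization and never see the matrix. -/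
lemma bilin_flatChristoffel {y : F} (hs : ∀ y v w, G y v w = G y w v)
    (hpos : ∀ u, u ≠ 0 → 0 < G y u u) (u v w : F) :
    G y (flatChristoffel G y u v) w = flatChristoffelFirst G y u v w := by
  have hbasis : ∀ j, G y (flatChristoffel G y u v) (Module.finBasis ℝ F j) =
      flatChristoffelFirst G y u v (Module.finBasis ℝ F j) := by
    intro j
    set A := flatGram (G y) with hA
    set φ : Fin (Module.finrank ℝ F) → ℝ :=
      fun l ↦ flatChristoffelFirst G y u v (Module.finBasis ℝ F l) with hφ
    have h1 : G y (flatChristoffel G y u v) (Module.finBasis ℝ F j) =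
        (A.mulVec (A⁻¹.mulVec φ)) j := by
      rw [hs]
      simp only [flatChristoffel, map_sum, map_smul, Matrix.mulVec, dotProduct, ← hA, smul_eq_mul]
      refine Finset.sum_congr rfl fun k _ ↦ ?_
      rw [mul_comm]
      rfl
    rw [h1, Matrix.mulVec_mulVec,
      Matrix.mul_nonsing_inv _ ((Matrix.isUnit_iff_isUnit_det _).1 (isUnit_flatGram (hs y) hpos)),
      Matrix.one_mulVec]
  -- Both sides are linear in the last argument, so agreement on the basis is enough.
  let L : F →ₗ[ℝ] ℝ :=
    { toFun := flatChristoffelFirst G y u v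
      map_add' := fun a b ↦ by simp only [flatChristoffelFirst, map_add, _root_.add_apply]; ring
      map_smul' := fun r a ↦ by
        simp only [flatChristoffelFirst, map_smul, _root_.smul_apply, smul_eq_mul, RingHom.id_apply]
        ring }
  have hL : (G y (flatChristoffel G y u v) : F →ₗ[ℝ] ℝ) = L :=
    (Module.finBasis ℝ F).ext hbasis
  exact LinearMap.congr_fun hL w

/-- The Levi-Civita connection is metric. -/
lemma fderiv_eq_flatChristoffel {y : F} (hG : DifferentiableAt ℝ G y)
    (hs : ∀ y v w, G y v w = G y w v) (hpos : ∀ u, u ≠ 0 → 0 < G y u u) (a u v : F) :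
    fderiv ℝ G y a u v =
      G y (flatChristoffel G y a u) v + G y u (flatChristoffel G y a v) := by
  rw [hs y u, bilin_flatChristoffel hs hpos, bilin_flatChristoffel hs hpos, flatChristoffelFirst,
    flatChristoffelFirst, fderiv_bilin_symm hG hs a v u]
  ring

/-- The Levi-Civita connection is torsion free. -/
lemma flatChristoffel_symm {y : F} (hG : DifferentiableAt ℝ G y)
    (hs : ∀ y v w, G y v w = G y w v) (u v : F) :
    flatChristoffel G y u v = flatChristoffel G y v u := by
  have : ∀ w, flatChristoffelFirst G y u v w = flatChristoffelFirst G y v u w := fun w ↦ by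
    rw [flatChristoffelFirst, flatChristoffelFirst, fderiv_bilin_symm hG hs w u v]
    ring
  simp only [flatChristoffel, this]

/-- This is the regularity that local existence for the geodesic equation requires. -/
lemma contDiffAt_flatChristoffel {y : F} (hG : ContDiffAt ℝ 2 G y)
    (hs : ∀ y v w, G y v w = G y w v) (hpos : ∀ u, u ≠ 0 → 0 < G y u u) (v : F) :
    ContDiffAt ℝ 1 (fun p : F × F ↦ flatChristoffel G p.1 p.2 p.2) (y, v) := by
  have hG1 : ContDiffAt ℝ 1 (fun p : F × F ↦ G p.1) (y, v) :=
    ContDiffAt.comp (y, v) (g := G) (hG.of_le one_le_two) contDiffAt_fst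
  have hDG0 : ContDiffAt ℝ 1 (fderiv ℝ G) y := hG.fderiv_right (m := 1) (by norm_num)
  have hDG : ContDiffAt ℝ 1 (fun p : F × F ↦ fderiv ℝ G p.1) (y, v) :=
    hDG0.comp (y, v) contDiffAt_fst
  have hsnd : ContDiffAt ℝ 1 (fun p : F × F ↦ p.2) (y, v) := contDiffAt_snd
  unfold flatChristoffel flatChristoffelFirst
  refine ContDiffAt.sum fun k _ ↦ ContDiffAt.smul (ContDiffAt.sum fun l _ ↦
    ContDiffAt.mul ?_ ?_) contDiffAt_const
  · refine ContDiffAt.matrix_inv (A := fun p : F × F ↦ flatGram (G p.1)) (fun i j ↦ ?_)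
      (isUnit_flatGram (hs y) hpos) k l
    exact (hG1.clm_apply contDiffAt_const).clm_apply contDiffAt_const
  · refine ContDiffAt.div_const (ContDiffAt.sub (ContDiffAt.add ?_ ?_) ?_) _
    · exact ((hDG.clm_apply hsnd).clm_apply hsnd).clm_apply contDiffAt_const
    · exact ((hDG.clm_apply hsnd).clm_apply hsnd).clm_apply contDiffAt_const
    · exact ((hDG.clm_apply contDiffAt_const).clm_apply hsnd).clm_apply hsnd

end FlatMetric

/-! ### Symmetry of the Hessian, and first variation of Clairaut's relation, in a vector space. -/

section FlatCalculus

variable {E : Type*} [NormedAddCommGroup E] [NormedSpace ℝ E]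
  {F : Type*} [NormedAddCommGroup F] [NormedSpace ℝ F] [FiniteDimensional ℝ F]
  {G : F → F →L[ℝ] F →L[ℝ] ℝ}

/-- The Hessian of a map into a space with metric `G`, taken with the Levi-Civita connection of
`G`. -/
def flatHessian (G : F → F →L[ℝ] F →L[ℝ] ℝ) (f : E → F) (x w z : E) : F :=
  fderiv ℝ (fderiv ℝ f) x w z + flatChristoffel G (f x) (fderiv ℝ f x w) (fderiv ℝ f x z)

lemma flatHessian_symm {f : E → F} {x : E} (hf : ContDiffAt ℝ 2 f x)
    (hG : DifferentiableAt ℝ G (f x)) (hs : ∀ y v w, G y v w = G y w v) (w z : E) :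
    flatHessian G f x w z = flatHessian G f x z w := by
  rw [flatHessian, flatHessian, flatChristoffel_symm hG hs,
    (hf.isSymmSndFDerivAt (by simp)).eq w z]

/-- For an anti-invariant map, the Hessian is totally symmetric when it is tested on
`Ψ (range f_*)`. -/
lemma bilin_flatHessian_symm {f : E → F} {x : E} {Ψ : F → F →L[ℝ] F}
    (hf : ContDiffAt ℝ 2 f x) (hG : DifferentiableAt ℝ G (f x))
    (hs : ∀ y v w, G y v w = G y w v) (hpos : ∀ u, u ≠ 0 → 0 < G (f x) u u)
    (hΨ : DifferentiableAt ℝ Ψ (f x))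
    (hanti : ∀ᶠ x' in 𝓝 x, ∀ z w,
      G (f x') (Ψ (f x') (fderiv ℝ f x' z)) (fderiv ℝ f x' w) = 0)
    (hskew : ∀ u v, G (f x) (Ψ (f x) u) v = -G (f x) u (Ψ (f x) v))
    (htrans : ∀ w z z', G (f x) (fderiv ℝ Ψ (f x) (fderiv ℝ f x w) (fderiv ℝ f x z)
        + flatChristoffel G (f x) (fderiv ℝ f x w) (Ψ (f x) (fderiv ℝ f x z))
        - Ψ (f x) (flatChristoffel G (f x) (fderiv ℝ f x w) (fderiv ℝ f x z)))
        (fderiv ℝ f x z') = 0) (w z z' : E) :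
    G (f x) (flatHessian G f x w z) (Ψ (f x) (fderiv ℝ f x z')) =
      G (f x) (flatHessian G f x w z') (Ψ (f x) (fderiv ℝ f x z)) := by
  have hf1 : HasFDerivAt f (fderiv ℝ f x) x := (hf.differentiableAt (by simp)).hasFDerivAt
  have hf2 : HasFDerivAt (fderiv ℝ f) (fderiv ℝ (fderiv ℝ f) x) x :=
    ((hf.fderiv_right (m := 1) (by norm_num)).differentiableAt (by simp)).hasFDerivAt
  have hG1 := hG.hasFDerivAt.comp x hf1
  have hΨ1 := hΨ.hasFDerivAt.comp x hf1
  have hz := hf2.clm_apply (hasFDerivAt_const z x)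
  have hz' := hf2.clm_apply (hasFDerivAt_const z' x)
  -- The derivative of G(Ψ f_*z, f_*z'), which vanishes near x by anti-invariance.
  have key := (hG1.clm_apply (hΨ1.clm_apply hz)).clm_apply hz'
  have hzero := (hasFDerivAt_const (𝕜 := ℝ) (0 : ℝ) x).congr_of_eventuallyEq
    (hanti.mono fun x' hx' ↦ hx' z z')
  have h := DFunLike.congr_fun (key.unique hzero) w
  have ht := htrans w z z'
  simp at h ht
  -- Metric compatibility completes the ordinary derivatives to covariant ones; the ∇Ψ part then
  -- cancels by `ht`.
  rw [fderiv_eq_flatChristoffel hG hs hpos] at h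
  simp only [flatHessian, map_add, _root_.add_apply]
  have e1 := hskew (fderiv ℝ (fderiv ℝ f) x w z) (fderiv ℝ f x z')
  have e2 := hskew (flatChristoffel G (f x) (fderiv ℝ f x w) (fderiv ℝ f x z)) (fderiv ℝ f x z')
  rw [hs _ (fderiv ℝ (fderiv ℝ f) x w z') (Ψ (f x) (fderiv ℝ f x z)),
    hs _ (flatChristoffel G (f x) (fderiv ℝ f x w) (fderiv ℝ f x z'))
      (Ψ (f x) (fderiv ℝ f x z))]
  linarith

/-- Leibniz rule for the metric along a curve. -/
lemma hasDerivAt_bilin {γ a b : ℝ → F} {v a' b' : F} {s : ℝ} (hG : DifferentiableAt ℝ G (γ s))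
    (hs : ∀ y v w, G y v w = G y w v) (hpos : ∀ u, u ≠ 0 → 0 < G (γ s) u u)
    (hγ : HasDerivAt γ v s) (ha : HasDerivAt a a' s) (hb : HasDerivAt b b' s) :
    HasDerivAt (fun t ↦ G (γ t) (a t) (b t))
      (G (γ s) (a' + flatChristoffel G (γ s) v (a s)) (b s) +
        G (γ s) (a s) (b' + flatChristoffel G (γ s) v (b s))) s := by
  have h := ((hG.hasFDerivAt.comp_hasDerivAt s hγ).clm_apply ha).clm_apply hb
  refine h.congr_deriv ?_
  simp only [map_add, _root_.add_apply, Function.comp_apply]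
  rw [fderiv_eq_flatChristoffel hG hs hpos]
  ring

/-- The first variation of Clairaut's relation along a geodesic with velocity `x + u`. -/
lemma bilin_covDeriv_eq_of_clairaut {γ σ : ℝ → F} {X : F → F} {h : F → ℝ} {y u : F} {K : ℝ}
    (hG : DifferentiableAt ℝ G y) (hs : ∀ y v w, G y v w = G y w v)
    (hpos : ∀ u, u ≠ 0 → 0 < G y u u) (hX : DifferentiableAt ℝ X y)
    (hh : DifferentiableAt ℝ h y) (hγ0 : γ 0 = y) (hσ0 : σ 0 = X y + u) (hu : G y (X y) u = 0)
    (hγ : HasDerivAt γ (X y + u) 0)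
    (hσ : HasDerivAt σ (-flatChristoffel G y (X y + u) (X y + u)) 0)
    (hle : ∀ᶠ s in 𝓝 (0 : ℝ), 2 * G (γ s) (X (γ s)) (σ s) - G (γ s) (X (γ s)) (X (γ s)) ≤
      K * Real.exp (-2 * h (γ s)) * G (γ s) (σ s) (σ s))
    (heq : G y (X y) (X y) = K * Real.exp (-2 * h y) * G y (X y + u) (X y + u)) :
    G y (fderiv ℝ X y (X y + u) + flatChristoffel G y (X y + u) (X y)) u =
      -(G y (X y) (X y) * fderiv ℝ h y (X y + u)) := by
  subst hγ0
  have dX : HasDerivAt (fun s ↦ X (γ s)) (fderiv ℝ X (γ 0) (X (γ 0) + u)) 0 :=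
    hX.hasFDerivAt.comp_hasDerivAt 0 hγ
  have dh : HasDerivAt (fun s ↦ h (γ s)) (fderiv ℝ h (γ 0) (X (γ 0) + u)) 0 :=
    hh.hasFDerivAt.comp_hasDerivAt 0 hγ
  have d1 := hasDerivAt_bilin hG hs hpos hγ dX hσ
  have d2 := hasDerivAt_bilin hG hs hpos hγ dX dX
  have d3 := hasDerivAt_bilin hG hs hpos hγ hσ hσ
  have dR := (((dh.const_mul (-2)).exp.const_mul K).mul d3).sub ((d1.const_mul 2).sub d2)
  -- The inequality is sharp at time 0, so its defect has a minimum there and both sides have the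
  -- same derivative.
  have hmin : IsLocalMin (fun s ↦ K * Real.exp (-2 * h (γ s)) * G (γ s) (σ s) (σ s) -
      (2 * G (γ s) (X (γ s)) (σ s) - G (γ s) (X (γ s)) (X (γ s)))) 0 := by
    filter_upwards [hle] with s hs'
    have e0 : K * Real.exp (-2 * h (γ 0)) * G (γ 0) (σ 0) (σ 0) -
        (2 * G (γ 0) (X (γ 0)) (σ 0) - G (γ 0) (X (γ 0)) (X (γ 0))) = 0 := by
      rw [hσ0, ← heq, map_add, hu]; ring
    rw [e0]
    linarith
  have hz := hmin.hasDerivAt_eq_zero dR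
  -- The geodesic equation removes every covariant derivative of σ; only those of X and the
  -- derivative of h survive.
  simp only [hσ0, neg_add_cancel, map_zero, _root_.zero_apply, add_zero, mul_zero] at hz
  set c := G (γ 0) (X (γ 0)) (X (γ 0)) with hc
  set A := fderiv ℝ X (γ 0) (X (γ 0) + u) + flatChristoffel G (γ 0) (X (γ 0) + u) (X (γ 0)) with hA
  rw [hs _ (X (γ 0)) A, map_add (G (γ 0) A)] at hz
  have e : K * (Real.exp (-2 * h (γ 0)) * (-2 * fderiv ℝ h (γ 0) (X (γ 0) + u))) *
      G (γ 0) (X (γ 0) + u) (X (γ 0) + u) = -2 * fderiv ℝ h (γ 0) (X (γ 0) + u) * c := by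
    rw [heq]; ring
  rw [e] at hz
  linarith

/-- If L is a left inverse of T(x), then P = T (L T)⁻¹ L is, near x, a differentiable family of
projections onto the range of T. From Y = P Y and Y(x) = 0 the product rule leaves Y' = P(x) Y',
because the term with the derivative of P is multiplied by Y(x). -/
lemma fderiv_mem_range_of_eventually_mem_range {k : ℕ} {T : E → (Fin k → ℝ) →L[ℝ] F} {Y : E → F}
    {x : E} (hT : DifferentiableAt ℝ T x) (hinj : Function.Injective (T x))
    (hY : DifferentiableAt ℝ Y x) (hmem : ∀ᶠ x' in 𝓝 x, ∃ a, Y x' = T x' a) (h0 : Y x = 0)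
    (w : E) : ∃ a, fderiv ℝ Y x w = T x a := by
  obtain ⟨L₀, hL₀⟩ := LinearMap.exists_leftInverse_of_injective (T x).toLinearMap
    (LinearMap.ker_eq_bot.2 hinj)
  set L : F →L[ℝ] (Fin k → ℝ) := LinearMap.toContinuousLinearMap L₀ with hL
  set A : E → (Fin k → ℝ) →L[ℝ] (Fin k → ℝ) := fun x' ↦ L.comp (T x') with hA
  have hAd : DifferentiableAt ℝ A x := (differentiableAt_const L).clm_comp hT
  have hA1 : A x = 1 := by
    ext a i
    exact congrFun (LinearMap.congr_fun hL₀ a) i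
  -- L T is the identity at x, and the invertible operators form an open set.
  have hAu : ∀ᶠ x' in 𝓝 x, IsUnit (A x') :=
    hAd.continuousAt.eventually (Units.isOpen.mem_nhds (by rw [hA1]; exact isUnit_one))
  have hRd : DifferentiableAt ℝ (fun x' ↦ Ring.inverse (A x')) x := by
    have h1 : DifferentiableAt ℝ (Ring.inverse : ((Fin k → ℝ) →L[ℝ] (Fin k → ℝ)) → _) (A x) := by
      rw [hA1]
      exact (hasFDerivAt_ringInverse (𝕜 := ℝ)
        (1 : ((Fin k → ℝ) →L[ℝ] (Fin k → ℝ))ˣ)).differentiableAt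
    exact h1.comp x hAd
  have hSd : DifferentiableAt ℝ (fun x' ↦ (T x').comp ((Ring.inverse (A x')).comp L)) x :=
    hT.clm_comp (hRd.clm_comp (differentiableAt_const L))
  have hYS : Y =ᶠ[𝓝 x] fun x' ↦ (T x').comp ((Ring.inverse (A x')).comp L) (Y x') := by
    filter_upwards [hmem, hAu] with x' ⟨a, ha⟩ hu
    have h1 : L (T x' a) = A x' a := rfl
    have h2 : Ring.inverse (A x') (A x' a) = a := by
      change (Ring.inverse (A x') * A x') a = a
      rw [Ring.inverse_mul_cancel _ hu]; rfl
    simp [ha, h1, h2]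
  have hd := hSd.hasFDerivAt.clm_apply hY.hasFDerivAt
  have hd' := (hd.congr_of_eventuallyEq hYS).fderiv
  refine ⟨Ring.inverse (A x) (L (fderiv ℝ Y x w)), ?_⟩
  conv_lhs => rw [hd']
  simp [h0]

end FlatCalculus

lemma two_le_infty : (2 : WithTop ℕ∞) ≤ ∞ :=
  WithTop.coe_le_coe.2 (le_top : (2 : ℕ∞) ≤ ⊤)

/-! ### Derivatives of maps and functions read in charts. -/

section ChartDerivatives

variable {E : Type*} [NormedAddCommGroup E] [NormedSpace ℝ E] [FiniteDimensional ℝ E]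
  {M : Type*} [TopologicalSpace M] [ChartedSpace E M] [IsManifold 𝓘(ℝ, E) ∞ M]
  {F : Type*} [NormedAddCommGroup F] [NormedSpace ℝ F] [FiniteDimensional ℝ F]
  {B : Type*} [TopologicalSpace B] [ChartedSpace F B] [IsManifold 𝓘(ℝ, F) ∞ B]
  {N : Type*} [TopologicalSpace N] [ChartedSpace E N]

lemma mvfderiv_eq_fderiv {g : E → F} {x : E} (w : E) :
    mvfderiv 𝓘(ℝ, E) g x w = fderiv ℝ g x w := by
  unfold mvfderiv
  rw [mfderiv_eq_fderiv]
  rfl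

lemma mvfderiv_congr {g g' : N → F} {q : N} (h : g =ᶠ[𝓝 q] g') (w : TangentSpace 𝓘(ℝ, E) q) :
    mvfderiv 𝓘(ℝ, E) g q w = mvfderiv 𝓘(ℝ, E) g' q w := by
  unfold mvfderiv
  rw [h.mfderiv_eq]
  rfl

lemma mdifferentiableAt_extChart {c x : B} (hx : x ∈ (chartAt F c).source) :
    MDifferentiableAt 𝓘(ℝ, F) 𝓘(ℝ, F) (extChartAt 𝓘(ℝ, F) c) x :=
  mdifferentiableAt_extChartAt hx

lemma coordVec_mfderiv {c : B} {f : N → B} {q : N} (hq : f q ∈ (chartAt F c).source)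
    (hf : MDifferentiableAt 𝓘(ℝ, E) 𝓘(ℝ, F) f q) (w : TangentSpace 𝓘(ℝ, E) q) :
    coordVec c (f q) (mfderiv 𝓘(ℝ, E) 𝓘(ℝ, F) f q w) =
      mvfderiv 𝓘(ℝ, E) (fun x ↦ extChartAt 𝓘(ℝ, F) c (f x)) q w := by
  unfold coordVec mvfderiv
  have := mfderiv_comp q (mdifferentiableAt_extChart hq) hf
  exact (DFunLike.congr_fun this w).symm

/-- The derivative of a vector valued function, read in a chart. -/
lemma mvfderiv_eq_fderiv_coordVec {p q : M} (hq : q ∈ (chartAt E p).source) {g : M → F}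
    (hg : DifferentiableAt ℝ (fun x ↦ g ((extChartAt 𝓘(ℝ, E) p).symm x)) (extChartAt 𝓘(ℝ, E) p q))
    (w : TangentSpace 𝓘(ℝ, E) q) :
    mvfderiv 𝓘(ℝ, E) g q w =
      fderiv ℝ (fun x ↦ g ((extChartAt 𝓘(ℝ, E) p).symm x)) (extChartAt 𝓘(ℝ, E) p q)
        (coordVec p q w) := by
  have h1 : g =ᶠ[𝓝 q] (fun x ↦ g ((extChartAt 𝓘(ℝ, E) p).symm x)) ∘ extChartAt 𝓘(ℝ, E) p := by
    filter_upwards [(chartAt E p).open_source.mem_nhds hq] with x hx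
    simp only [Function.comp_apply]
    rw [(extChartAt 𝓘(ℝ, E) p).left_inv (by simpa using hx)]
  rw [mvfderiv_congr h1]
  unfold coordVec mvfderiv
  have := mfderiv_comp q hg.mdifferentiableAt (mdifferentiableAt_extChart hq)
  rw [mfderiv_eq_fderiv] at this
  exact DFunLike.congr_fun this w

end ChartDerivatives

/-! ### Local existence of geodesics. -/

section Geodesics

variable {F : Type*} [NormedAddCommGroup F] [NormedSpace ℝ F] [FiniteDimensional ℝ F]
  {B : Type*} [TopologicalSpace B] [ChartedSpace F B] [IsManifold 𝓘(ℝ, F) ∞ B]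
  [RiemannianBundle (fun x : B ↦ TangentSpace 𝓘(ℝ, F) x)]
  [IsContMDiffRiemannianBundle 𝓘(ℝ, F) ∞ F (fun x : B ↦ TangentSpace 𝓘(ℝ, F) x)]

lemma contDiffAt_metricForm {c : B} {y : F} (hy : y ∈ (extChartAt 𝓘(ℝ, F) c).target) :
    ContDiffAt ℝ ∞ (metricForm c) y :=
  (contDiffOn_metricForm c).contDiffAt ((isOpen_extChartAt_target c).mem_nhds hy)

lemma differentiableAt_metricForm {c : B} {y : F} (hy : y ∈ (extChartAt 𝓘(ℝ, F) c).target) :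
    DifferentiableAt ℝ (metricForm c) y :=
  (contDiffAt_metricForm hy).differentiableAt (by simp)

lemma christoffel_eq_flatChristoffel {c : B} {y : F} (hy : y ∈ (extChartAt 𝓘(ℝ, F) c).target)
    (u v : F) : christoffel c y u v = flatChristoffel (metricForm c) y u v := by
  have : ∀ w, christoffelFirst c y u v w = flatChristoffelFirst (metricForm c) y u v w := by
    intro w
    simp only [christoffelFirst, flatChristoffelFirst, ← metricForm_apply,
      fderiv_bilin_apply (differentiableAt_metricForm hy)]
  simp only [christoffel, flatChristoffel, this]
  rfl

/-- Picard–Lindelöf for the first-order system γ' = σ, σ' = -Γ(σ, σ); continuity lets the interval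
shrink until the curve stays in the chart and in `U`. -/
lemma exists_geodesic_coord (b : B) (v : F) {U : Set B} (hU : IsOpen U) (hb : b ∈ U) :
    ∃ ε > 0, ∃ γ σ : ℝ → F, γ 0 = extChartAt 𝓘(ℝ, F) b b ∧ σ 0 = v ∧
      ∀ s ∈ Ioo (-ε) ε, γ s ∈ (extChartAt 𝓘(ℝ, F) b).target ∧
        (extChartAt 𝓘(ℝ, F) b).symm (γ s) ∈ U ∧ HasDerivAt γ (σ s) s ∧
        HasDerivAt σ (-flatChristoffel (metricForm b) (γ s) (σ s) (σ s)) s := by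
  have hy := mem_extChartAt_target (I := 𝓘(ℝ, F)) b
  have hvf : ContDiffAt ℝ 1
      (fun p : F × F ↦ (p.2, -flatChristoffel (metricForm b) p.1 p.2 p.2))
      (extChartAt 𝓘(ℝ, F) b b, v) :=
    contDiffAt_snd.prodMk (contDiffAt_flatChristoffel
      ((contDiffAt_metricForm hy).of_le two_le_infty)
      (metricForm_symm b) (fun u hu ↦ metricForm_self_pos hy hu) v).neg
  obtain ⟨α, hα0, ε, hε, hα⟩ :=
    hvf.exists_forall_mem_closedBall_exists_eq_forall_mem_Ioo_hasDerivAt₀ 0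
  have hc0 : ContinuousAt α 0 := (hα 0 ⟨by simpa using hε, by simpa using hε⟩).continuousAt
  have hO : IsOpen ((extChartAt 𝓘(ℝ, F) b).target ∩ (extChartAt 𝓘(ℝ, F) b).symm ⁻¹' U) :=
    (continuousOn_extChartAt_symm b).isOpen_inter_preimage (isOpen_extChartAt_target b) hU
  have hev : ∀ᶠ s in 𝓝 (0 : ℝ), (α s).1 ∈
      (extChartAt 𝓘(ℝ, F) b).target ∩ (extChartAt 𝓘(ℝ, F) b).symm ⁻¹' U := by
    refine (continuousAt_fst.comp hc0).eventually_mem (hO.mem_nhds ?_)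
    simp only [Function.comp_apply, hα0]
    refine ⟨hy, ?_⟩
    rw [mem_preimage, extChartAt_to_inv]
    exact hb
  obtain ⟨δ, hδ, hball⟩ := Metric.eventually_nhds_iff.1 hev
  refine ⟨min ε δ, lt_min hε hδ, fun s ↦ (α s).1, fun s ↦ (α s).2, by simp [hα0], by simp [hα0],
    fun s hs ↦ ?_⟩
  have hs1 : s ∈ Ioo (0 - ε) (0 + ε) := by
    constructor
    · linarith [hs.1, min_le_left ε δ]
    · linarith [hs.2, min_le_left ε δ]
  have hs2 : dist s 0 < δ := by
    rw [Real.dist_0_eq_abs]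
    exact abs_lt.2 ⟨by linarith [hs.1, min_le_right ε δ], by linarith [hs.2, min_le_right ε δ]⟩
  have hd := hα s hs1
  exact ⟨(hball hs2).1, (hball hs2).2,
    (hasFDerivAt_fst (𝕜 := ℝ) (p := α s)).comp_hasDerivAt s hd,
    (hasFDerivAt_snd (𝕜 := ℝ) (p := α s)).comp_hasDerivAt s hd⟩

variable {b : B} {γ σ : ℝ → F} {J : Set ℝ}

lemma coordVec_velocity (hJ : IsOpen J)
    (hγ : ∀ s ∈ J, γ s ∈ (extChartAt 𝓘(ℝ, F) b).target ∧ HasDerivAt γ (σ s) s) {s : ℝ}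
    (hs : s ∈ J) :
    coordVec b ((extChartAt 𝓘(ℝ, F) b).symm (γ s))
      (velocity (F := F) (fun t ↦ (extChartAt 𝓘(ℝ, F) b).symm (γ t)) s) = σ s := by
  have hsrc : (extChartAt 𝓘(ℝ, F) b).symm (γ s) ∈ (chartAt F b).source := by
    simpa using (extChartAt 𝓘(ℝ, F) b).map_target (hγ s hs).1
  have hm : MDifferentiableAt 𝓘(ℝ, ℝ) 𝓘(ℝ, F) (fun t ↦ (extChartAt 𝓘(ℝ, F) b).symm (γ t)) s := by
    have h1 : MDifferentiableAt 𝓘(ℝ, F) 𝓘(ℝ, F) (extChartAt 𝓘(ℝ, F) b).symm (γ s) :=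
      (((contMDiffOn_extChartAt_symm (n := ∞) b) _ (hγ s hs).1).contMDiffAt
        ((isOpen_extChartAt_target b).mem_nhds (hγ s hs).1)).mdifferentiableAt (by simp)
    exact MDifferentiableAt.comp s h1 (hγ s hs).2.differentiableAt.mdifferentiableAt
  refine (coordVec_mfderiv (E := ℝ) (f := fun t ↦ (extChartAt 𝓘(ℝ, F) b).symm (γ t))
    hsrc hm (1 : ℝ)).trans ?_
  have hev : (fun t ↦ extChartAt 𝓘(ℝ, F) b ((extChartAt 𝓘(ℝ, F) b).symm (γ t))) =ᶠ[𝓝 s] γ := by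
    filter_upwards [hJ.mem_nhds hs] with t ht
    exact (extChartAt 𝓘(ℝ, F) b).right_inv (hγ t ht).1
  refine (mvfderiv_congr hev (1 : ℝ)).trans ((mvfderiv_eq_fderiv (E := ℝ) (1 : ℝ)).trans ?_)
  rw [(hγ s hs).2.hasFDerivAt.fderiv]
  simp

/-- The system itself supplies the regularity: σ' is continuous because Γ is, hence σ is C¹ and γ,
having derivative σ, is C². -/
lemma isGeodesicOn_of_coord (hJ : IsOpen J)
    (hγ : ∀ s ∈ J, γ s ∈ (extChartAt 𝓘(ℝ, F) b).target ∧ HasDerivAt γ (σ s) s)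
    (hσ : ∀ s ∈ J, HasDerivAt σ (-flatChristoffel (metricForm b) (γ s) (σ s) (σ s)) s) :
    IsGeodesicOn (F := F) (fun t ↦ (extChartAt 𝓘(ℝ, F) b).symm (γ t)) J := by
  have hcd1 : ContDiffOn ℝ 1 σ J := by
    have h : ContDiffOn ℝ (0 + 1) σ J := by
      refine (contDiffOn_succ_iff_deriv_of_isOpen hJ).2
        ⟨fun s hs ↦ (hσ s hs).differentiableAt.differentiableWithinAt, by simp, ?_⟩
      rw [contDiffOn_zero]
      refine ContinuousOn.congr (f := fun s ↦ -flatChristoffel (metricForm b) (γ s) (σ s) (σ s))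
        (fun s hs ↦ ContinuousAt.continuousWithinAt ?_) fun s hs ↦ (hσ s hs).deriv
      have hy := (hγ s hs).1
      have h0 := (contDiffAt_flatChristoffel ((contDiffAt_metricForm hy).of_le two_le_infty)
        (metricForm_symm b) (fun u hu ↦ metricForm_self_pos hy hu) (σ s)).continuousAt
      exact (ContinuousAt.comp (f := fun s ↦ (γ s, σ s)) h0
        ((hγ s hs).2.continuousAt.prodMk (hσ s hs).continuousAt)).neg
    simpa using h
  have hcd : ContDiffOn ℝ 2 γ J := by
    have h : ContDiffOn ℝ (1 + 1) γ J := (contDiffOn_succ_iff_deriv_of_isOpen hJ).2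
      ⟨fun s hs ↦ (hγ s hs).2.differentiableAt.differentiableWithinAt, by simp,
        hcd1.congr fun s hs ↦ (hγ s hs).2.deriv⟩
    rwa [one_add_one_eq_two] at h
  refine ⟨?_, fun s hs ↦ ⟨b, ?_, ?_⟩⟩
  · exact ((contMDiffOn_extChartAt_symm (n := ∞) b).of_le two_le_infty).comp
      hcd.contMDiffOn fun s hs ↦ (hγ s hs).1
  · simpa using (extChartAt 𝓘(ℝ, F) b).map_target (hγ s hs).1
  · unfold covDerivAlongIn
    have hev : (fun t ↦ coordVec b ((extChartAt 𝓘(ℝ, F) b).symm (γ t))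
        (velocity (F := F) (fun t ↦ (extChartAt 𝓘(ℝ, F) b).symm (γ t)) t)) =ᶠ[𝓝 s] σ := by
      filter_upwards [hJ.mem_nhds hs] with t ht using coordVec_velocity hJ hγ ht
    have h1 : mvfderiv 𝓘(ℝ, ℝ) (fun t ↦ coordVec b ((extChartAt 𝓘(ℝ, F) b).symm (γ t))
        (velocity (F := F) (fun t ↦ (extChartAt 𝓘(ℝ, F) b).symm (γ t)) t)) s (1 : ℝ) =
          -flatChristoffel (metricForm b) (γ s) (σ s) (σ s) := by
      refine (mvfderiv_congr hev (1 : ℝ)).trans ((mvfderiv_eq_fderiv (E := ℝ) (1 : ℝ)).trans ?_)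
      rw [(hσ s hs).hasFDerivAt.fderiv]
      simp
    have h2 := coordVec_velocity hJ hγ hs
    have h3 := h2
    unfold velocity at h3
    rw [h1, h2, h3, (extChartAt 𝓘(ℝ, F) b).right_inv (hγ s hs).1,
      christoffel_eq_flatChristoffel (hγ s hs).1, neg_add_cancel, map_zero]

end Geodesics

/-! ### The map and its Hessian in charts. -/

section CoordinateRepresentation

variable {E : Type*} [NormedAddCommGroup E] [NormedSpace ℝ E] [FiniteDimensional ℝ E]
  {M : Type*} [TopologicalSpace M] [ChartedSpace E M] [IsManifold 𝓘(ℝ, E) ∞ M]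
  {F : Type*} [NormedAddCommGroup F] [NormedSpace ℝ F] [FiniteDimensional ℝ F]
  {B : Type*} [TopologicalSpace B] [ChartedSpace F B] [IsManifold 𝓘(ℝ, F) ∞ B]

/-- A map of manifolds in the charts centred at `p` and `f p`. -/
def coordRep (f : M → B) (p : M) (x : E) : F :=
  extChartAt 𝓘(ℝ, F) (f p) (f ((extChartAt 𝓘(ℝ, E) p).symm x))

lemma coordRep_extChartAt (f : M → B) {p q : M} (hq : q ∈ (chartAt E p).source) :
    coordRep (E := E) (F := F) f p (extChartAt 𝓘(ℝ, E) p q) =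
      extChartAt 𝓘(ℝ, F) (f p) (f q) := by
  unfold coordRep
  rw [(extChartAt 𝓘(ℝ, E) p).left_inv (by simpa using hq)]

lemma coordRep_self (f : M → B) (p : M) :
    coordRep (E := E) (F := F) f p (extChartAt 𝓘(ℝ, E) p p) =
      extChartAt 𝓘(ℝ, F) (f p) (f p) :=
  coordRep_extChartAt f (mem_chart_source E p)

variable {f : M → B}

lemma contDiffAt_coordRep (hf : ContMDiff 𝓘(ℝ, E) 𝓘(ℝ, F) ∞ f) {p : M} {x : E}
    (hx : x ∈ (extChartAt 𝓘(ℝ, E) p).target)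
    (hfx : f ((extChartAt 𝓘(ℝ, E) p).symm x) ∈ (chartAt F (f p)).source) :
    ContDiffAt ℝ ∞ (coordRep (E := E) (F := F) f p) x := by
  have h1 : ContMDiffAt 𝓘(ℝ, E) 𝓘(ℝ, E) ∞ (extChartAt 𝓘(ℝ, E) p).symm x :=
    ((contMDiffOn_extChartAt_symm p) x hx).contMDiffAt ((isOpen_extChartAt_target p).mem_nhds hx)
  have h2 : ContMDiffAt 𝓘(ℝ, F) 𝓘(ℝ, F) ∞ (extChartAt 𝓘(ℝ, F) (f p))
      (f ((extChartAt 𝓘(ℝ, E) p).symm x)) := contMDiffAt_extChartAt' hfx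
  exact (h2.comp x (hf.contMDiffAt.comp x h1)).contDiffAt

lemma eventually_mem_charts (hf : ContMDiff 𝓘(ℝ, E) 𝓘(ℝ, F) ∞ f) (p : M) :
    ∀ᶠ x in 𝓝 (extChartAt 𝓘(ℝ, E) p p), x ∈ (extChartAt 𝓘(ℝ, E) p).target ∧
      f ((extChartAt 𝓘(ℝ, E) p).symm x) ∈ (chartAt F (f p)).source := by
  refine Filter.Eventually.and ((isOpen_extChartAt_target p).mem_nhds (mem_extChartAt_target p)) ?_
  have h1 : ContinuousAt (fun x ↦ f ((extChartAt 𝓘(ℝ, E) p).symm x)) (extChartAt 𝓘(ℝ, E) p p) :=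
    hf.continuous.continuousAt.comp (continuousAt_extChartAt_symm p)
  refine h1.eventually_mem ((chartAt F (f p)).open_source.mem_nhds ?_)
  rw [extChartAt_to_inv]
  exact mem_chart_source F (f p)

lemma contDiffAt_coordRep_self (hf : ContMDiff 𝓘(ℝ, E) 𝓘(ℝ, F) ∞ f) (p : M) :
    ContDiffAt ℝ ∞ (coordRep (E := E) (F := F) f p) (extChartAt 𝓘(ℝ, E) p p) :=
  have h := (eventually_mem_charts hf p).self_of_nhds
  contDiffAt_coordRep hf h.1 h.2

lemma coordVec_pushforward (hf : ContMDiff 𝓘(ℝ, E) 𝓘(ℝ, F) ∞ f) {p q : M}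
    (hq : q ∈ (chartAt E p).source) (hfq : f q ∈ (chartAt F (f p)).source)
    (w : TangentSpace 𝓘(ℝ, E) q) :
    coordVec (f p) (f q) (pushforward (E := E) (F := F) f q w) =
      fderiv ℝ (coordRep (E := E) (F := F) f p) (extChartAt 𝓘(ℝ, E) p q) (coordVec p q w) := by
  unfold pushforward
  rw [coordVec_mfderiv hfq (hf.mdifferentiable (by simp) q)]
  refine mvfderiv_eq_fderiv_coordVec hq ?_ w
  exact (contDiffAt_coordRep hf ((extChartAt 𝓘(ℝ, E) p).map_source (by simpa using hq))
    (by rwa [(extChartAt 𝓘(ℝ, E) p).left_inv (by simpa using hq)])).differentiableAt (by simp)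

/-- The standard extension has constant components in the chart at p. Hence the ordinary derivative
of f_*Z is the plain second derivative of f in coordinates. -/
lemma coordVec_extend {p q : M} (hq : q ∈ (chartAt E p).source) (z : TangentSpace 𝓘(ℝ, E) p) :
    coordVec p q (FiberBundle.extend E z q) = coordVec p p z := by
  have hq' : q ∈ (trivializationAt E (TangentSpace 𝓘(ℝ, E)) p).baseSet := by simpa using hq
  have h : FiberBundle.extend E z q = ofCoordVec p q (coordVec p p z) := by
    rw [ofCoordVec_eq_symmL hq, Trivialization.symmL_apply _ hq',
      ← snd_trivializationAt (mem_chart_source E p)]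
    rfl
  rw [h, coordVec_ofCoordVec hq]

variable [RiemannianBundle (fun x : B ↦ TangentSpace 𝓘(ℝ, F) x)]
  [IsContMDiffRiemannianBundle 𝓘(ℝ, F) ∞ F (fun x : B ↦ TangentSpace 𝓘(ℝ, F) x)]

/-- The pullback connection applied to `f_* Z`, in charts. -/
lemma coordVec_covDerivAlong_pushforward (hf : ContMDiff 𝓘(ℝ, E) 𝓘(ℝ, F) ∞ f) (p : M)
    (w z : TangentSpace 𝓘(ℝ, E) p) :
    coordVec (f p) (f p) (covDerivAlong f
        (fun q ↦ pushforward (E := E) (F := F) f q (FiberBundle.extend E z q)) p w) =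
      flatHessian (metricForm (f p)) (coordRep (E := E) (F := F) f p) (extChartAt 𝓘(ℝ, E) p p)
        (coordVec p p w) (coordVec p p z) := by
  have hp := mem_chart_source E p
  have hb := mem_chart_source F (f p)
  have hev : (fun x ↦ coordVec (f p) (f ((extChartAt 𝓘(ℝ, E) p).symm x))
      (pushforward (E := E) (F := F) f ((extChartAt 𝓘(ℝ, E) p).symm x)
        (FiberBundle.extend E z ((extChartAt 𝓘(ℝ, E) p).symm x))))
      =ᶠ[𝓝 (extChartAt 𝓘(ℝ, E) p p)]
      fun x ↦ fderiv ℝ (coordRep (E := E) (F := F) f p) x (coordVec p p z) := by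
    filter_upwards [eventually_mem_charts hf p] with x ⟨hx, hfx⟩
    have hs : (extChartAt 𝓘(ℝ, E) p).symm x ∈ (chartAt E p).source := by
      simpa using (extChartAt 𝓘(ℝ, E) p).map_target hx
    rw [coordVec_pushforward hf hs hfx, coordVec_extend hs, (extChartAt 𝓘(ℝ, E) p).right_inv hx]
  have hd : DifferentiableAt ℝ (fderiv ℝ (coordRep (E := E) (F := F) f p))
      (extChartAt 𝓘(ℝ, E) p p) :=
    (((contDiffAt_coordRep_self hf p).of_le two_le_infty).fderiv_right (m := 1)
      (by norm_num)).differentiableAt (by simp)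
  have hd2 := hd.hasFDerivAt.clm_apply
    (hasFDerivAt_const (𝕜 := ℝ) (coordVec p p z) (extChartAt 𝓘(ℝ, E) p p))
  unfold covDerivAlong covDerivAlongIn
  rw [coordVec_ofCoordVec hb, mvfderiv_eq_fderiv_coordVec hp
    (hd2.congr_of_eventuallyEq hev).differentiableAt, hev.fderiv_eq, hd2.fderiv,
    christoffel_eq_flatChristoffel (mem_extChartAt_target (f p))]
  have e1 := coordVec_pushforward hf hp hb w
  have e2 := coordVec_pushforward hf hp hb (FiberBundle.extend E z p)
  rw [FiberBundle.extend_apply_self] at e2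
  unfold pushforward at e1 e2
  beta_reduce
  rw [FiberBundle.extend_apply_self]
  unfold pushforward
  rw [e1, e2, flatHessian, coordRep_self]
  simp

end CoordinateRepresentation

/-! ### The trans-Sasakian equation in charts. -/

section AlmostContact

variable {F : Type*} [NormedAddCommGroup F] [NormedSpace ℝ F] [FiniteDimensional ℝ F]
  {B : Type*} [TopologicalSpace B] [ChartedSpace F B] [IsManifold 𝓘(ℝ, F) ∞ B]
  [RiemannianBundle (fun x : B ↦ TangentSpace 𝓘(ℝ, F) x)]

/-- The `(1,1)`-tensor of an almost contact structure in a chart. -/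
def AlmostContactMetric.ψCoord (S : AlmostContactMetric F B) (c : B) (y : F) : F →L[ℝ] F :=
  (coordVec c ((extChartAt 𝓘(ℝ, F) c).symm y)).comp
    ((S.ψ ((extChartAt 𝓘(ℝ, F) c).symm y)).comp (ofCoordVec c ((extChartAt 𝓘(ℝ, F) c).symm y)))

namespace AlmostContactMetric

variable (S : AlmostContactMetric F B)

lemma ψCoord_coordVec {c x : B} (hx : x ∈ (chartAt F c).source) (v : TangentSpace 𝓘(ℝ, F) x) :
    S.ψCoord c (extChartAt 𝓘(ℝ, F) c x) (coordVec c x v) = coordVec c x (S.ψ x v) := by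
  have hx' : (extChartAt 𝓘(ℝ, F) c).symm (extChartAt 𝓘(ℝ, F) c x) = x :=
    (extChartAt 𝓘(ℝ, F) c).left_inv (by simpa using hx)
  have h : ∀ x', x' = x → (coordVec c x') ((S.ψ x') ((ofCoordVec c x') (coordVec c x v))) =
      coordVec c x (S.ψ x v) := by
    rintro x' rfl
    rw [ofCoordVec_coordVec hx]
  exact h _ hx'

lemma smoothFieldOn_ψ_ofCoordVec (c : B) (u : F) :
    SmoothFieldOn (fun x ↦ S.ψ x (ofCoordVec c x u)) (chartAt F c).source :=
  ContMDiffOn.clm_bundle_apply (E₁ := fun x : B ↦ TangentSpace 𝓘(ℝ, F) x) (F₁ := F)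
    (E₂ := fun x : B ↦ TangentSpace 𝓘(ℝ, F) x) (F₂ := F) (b := fun x : B ↦ x)
    S.smooth_ψ.contMDiffOn (smoothFieldOn_ofCoordVec c u)

lemma differentiableAt_ψCoord {c : B} {y : F} (hy : y ∈ (extChartAt 𝓘(ℝ, F) c).target) :
    DifferentiableAt ℝ (S.ψCoord c) y := by
  have : ContDiffOn ℝ ∞ (S.ψCoord c) (extChartAt 𝓘(ℝ, F) c).target :=
    contDiffOn_clm_apply.2 fun u z hz ↦
      ((S.smoothFieldOn_ψ_ofCoordVec c u).contDiffAt_coordVec (chartAt F c).open_source hz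
        (by simpa using (extChartAt 𝓘(ℝ, F) c).map_target hz)).contDiffWithinAt
  exact (this.contDiffAt ((isOpen_extChartAt_target c).mem_nhds hy)).differentiableAt (by simp)

variable [IsContMDiffRiemannianBundle 𝓘(ℝ, F) ∞ F (fun x : B ↦ TangentSpace 𝓘(ℝ, F) x)]

lemma coordVec_leviCivita {X : ∀ x : B, TangentSpace 𝓘(ℝ, F) x} {b : B} {X' : F → F}
    (hX : (fun y ↦ coordVec b ((extChartAt 𝓘(ℝ, F) b).symm y) (X ((extChartAt 𝓘(ℝ, F) b).symm y)))
      =ᶠ[𝓝 (extChartAt 𝓘(ℝ, F) b b)] X')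
    (hX' : DifferentiableAt ℝ X' (extChartAt 𝓘(ℝ, F) b b)) (w : TangentSpace 𝓘(ℝ, F) b) :
    coordVec b b (leviCivita X b w) =
      fderiv ℝ X' (extChartAt 𝓘(ℝ, F) b b) (coordVec b b w) +
        flatChristoffel (metricForm b) (extChartAt 𝓘(ℝ, F) b b) (coordVec b b w)
          (coordVec b b (X b)) := by
  have hb := mem_chart_source F b
  unfold leviCivita covDerivAlong covDerivAlongIn
  rw [coordVec_ofCoordVec hb, mvfderiv_eq_fderiv_coordVec hb
    (hX'.congr_of_eventuallyEq hX), hX.fderiv_eq,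
    christoffel_eq_flatChristoffel (mem_extChartAt_target b)]
  have : mfderiv 𝓘(ℝ, F) 𝓘(ℝ, F) (fun x : B ↦ x) b w = w := by
    rw [show (fun x : B ↦ x) = id from rfl, mfderiv_id]; rfl
  rw [this]

variable {S}

/-- The trans-Sasakian equation in a chart, tested on vectors orthogonal to the Reeb field. -/
lemma IsTransSasakian.metricForm_eq_zero {α β : B → ℝ} (hS : S.IsTransSasakian α β) {b : B}
    (w z x : TangentSpace 𝓘(ℝ, F) b) (hz : S.η b z = 0) (hx : (inner ℝ (S.ξ b) x : ℝ) = 0) :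
    metricForm b (extChartAt 𝓘(ℝ, F) b b)
      (fderiv ℝ (S.ψCoord b) (extChartAt 𝓘(ℝ, F) b b) (coordVec b b w) (coordVec b b z)
        + flatChristoffel (metricForm b) (extChartAt 𝓘(ℝ, F) b b) (coordVec b b w)
            (S.ψCoord b (extChartAt 𝓘(ℝ, F) b b) (coordVec b b z))
        - S.ψCoord b (extChartAt 𝓘(ℝ, F) b b) (flatChristoffel (metricForm b)
            (extChartAt 𝓘(ℝ, F) b b) (coordVec b b w) (coordVec b b z)))
      (coordVec b b x) = 0 := by
  have hb := mem_chart_source F b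
  have hy := mem_extChartAt_target (I := 𝓘(ℝ, F)) b
  set ζ := coordVec b b z with hζ
  have hZ : ofCoordVec b b ζ = z := ofCoordVec_coordVec hb z
  -- A field with constant components has zero ordinary derivative, so ∇Z contributes only a
  -- Christoffel term.
  have h := hS.2.2 (chartAt F b).source (fun q ↦ ofCoordVec b q ζ) (chartAt F b).open_source
    (smoothFieldOn_ofCoordVec b ζ) b hb w
  have hd := (S.differentiableAt_ψCoord hy).hasFDerivAt.clm_apply
    (hasFDerivAt_const (𝕜 := ℝ) ζ (extChartAt 𝓘(ℝ, F) b b))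
  have h1 := coordVec_leviCivita (X := fun q ↦ S.ψ q (ofCoordVec b q ζ)) (b := b)
    (X' := fun y ↦ S.ψCoord b y ζ) (Eventually.of_forall fun y ↦ rfl) hd.differentiableAt w
  have h2 := coordVec_leviCivita (X := fun q ↦ ofCoordVec b q ζ) (b := b)
    (X' := fun _ ↦ ζ) (by
      filter_upwards [(isOpen_extChartAt_target b).mem_nhds hy] with y hy'
      exact coordVec_ofCoordVec (by simpa using (extChartAt 𝓘(ℝ, F) b).map_target hy') ζ)
    (differentiableAt_const ζ) w
  simp only [hZ] at h h1 h2
  rw [hd.fderiv] at h1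
  rw [hz, zero_smul, zero_smul, sub_zero, sub_zero] at h
  have h3 := congrArg (fun v ↦ (inner ℝ v x : ℝ)) h
  -- With η(z) = 0 the right-hand side is a multiple of ξ, which is orthogonal to x.
  have hright : (inner ℝ (α b • ((inner ℝ w z : ℝ) • S.ξ b) +
      β b • ((inner ℝ (S.ψ b w) z : ℝ) • S.ξ b)) x : ℝ) = 0 := by
    rw [smul_smul, smul_smul, ← add_smul]
    exact (real_inner_smul_left _ _ _).trans (by rw [hx, mul_zero])
  have h4 := h3.trans hright
  rw [inner_eq_metricForm hb, map_sub, h1,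
    ← S.ψCoord_coordVec hb (leviCivita (fun q ↦ ofCoordVec b q ζ) b w), h2,
    ← S.ψCoord_coordVec hb z] at h4
  rw [← h4]
  simp [← hζ]

end AlmostContactMetric

end AlmostContact

/-! ### Clairaut's relation in a single tangent space. -/

section ClairautAngle

variable {V : Type*} [NormedAddCommGroup V] [InnerProductSpace ℝ V] {D : Submodule ℝ V}

/-- sin θ = |x| / |v| when x ⊥ u. Squaring and clearing denominators gives a form that is also valid
for v = 0, where the angle is only a convention. -/
lemma inner_self_eq_of_sin_angle {r C : ℝ} (hr : 0 < r) {v x u : V} (hx : x ∈ D) (hu : u ∈ Dᗮ)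
    (hv : v = x + u) (h : r * Real.sin (InnerProductGeometry.angle v u) = C) :
    (inner ℝ x x : ℝ) = C ^ 2 * (r ^ 2)⁻¹ * inner ℝ v v := by
  have hxu : (inner ℝ u x : ℝ) = 0 := D.inner_left_of_mem_orthogonal hx hu
  rcases eq_or_ne v 0 with h0 | h0
  · have hux : (inner ℝ (x + u) x : ℝ) = 0 := by rw [← hv, h0, inner_zero_left]
    rw [inner_add_left, hxu, add_zero] at hux
    rw [hux, h0, inner_zero_left, mul_zero]
  · have h1 : u ≠ 0 ∨ x ≠ 0 := by
      by_contra! h2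
      exact h0 (by rw [hv, h2.1, h2.2, add_zero])
    have h2 := InnerProductGeometry.sin_angle_add_of_inner_eq_zero hxu h1
    rw [add_comm u x, ← hv, InnerProductGeometry.angle_comm] at h2
    rw [h2] at h
    have h3 : ‖v‖ ≠ 0 := norm_ne_zero_iff.2 h0
    rw [real_inner_self_eq_norm_sq, real_inner_self_eq_norm_sq, ← h]
    field_simp

/-- With x the component of v in `D`, the left side equals |x|² - |z - x|². Any z in `D` is allowed,
so a smooth section can stand in for the projection. -/
lemma two_mul_inner_sub_le_of_sin_angle [D.HasOrthogonalProjection] {r C : ℝ} (hr : 0 < r) {v : V}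
    (h : ∀ x ∈ D, ∀ u ∈ Dᗮ, v = x + u → r * Real.sin (InnerProductGeometry.angle v u) = C)
    {z : V} (hz : z ∈ D) :
    2 * (inner ℝ z v : ℝ) - inner ℝ z z ≤ C ^ 2 * (r ^ 2)⁻¹ * inner ℝ v v := by
  obtain ⟨x, hx, u, hu, hv⟩ := D.exists_add_mem_mem_orthogonal v
  rw [← inner_self_eq_of_sin_angle hr hx hu hv (h x hx u hu hv)]
  have h1 : (inner ℝ z v : ℝ) = inner ℝ z x := by
    rw [hv, inner_add_right, D.inner_right_of_mem_orthogonal hz hu, add_zero]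
  have h2 : 0 ≤ (inner ℝ (z - x) (z - x) : ℝ) := real_inner_self_nonneg
  rw [inner_sub_left, inner_sub_right, inner_sub_right, real_inner_comm z x] at h2
  rw [h1]
  linarith

end ClairautAngle

/-! ### Clairaut's relation along geodesics, in a local frame of the distribution. -/

section Frames

variable {F : Type*} [NormedAddCommGroup F] [NormedSpace ℝ F] [FiniteDimensional ℝ F]
  {B : Type*} [TopologicalSpace B] [ChartedSpace F B] [IsManifold 𝓘(ℝ, F) ∞ B]

/-- Linear combinations of the vector fields `X i`, in a chart. -/
def frameCoord {k : ℕ} (X : Fin k → ∀ x : B, TangentSpace 𝓘(ℝ, F) x) (c : B) (y : F) :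
    (Fin k → ℝ) →L[ℝ] F :=
  ∑ i, (ContinuousLinearMap.proj (R := ℝ) (φ := fun _ : Fin k ↦ ℝ) i).smulRight
    (coordVec c ((extChartAt 𝓘(ℝ, F) c).symm y) (X i ((extChartAt 𝓘(ℝ, F) c).symm y)))

variable {k : ℕ} {X : Fin k → ∀ x : B, TangentSpace 𝓘(ℝ, F) x} {c : B}

lemma frameCoord_apply (y : F) (a : Fin k → ℝ) :
    frameCoord X c y a = coordVec c ((extChartAt 𝓘(ℝ, F) c).symm y)
      (∑ i, a i • X i ((extChartAt 𝓘(ℝ, F) c).symm y)) := by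
  rw [map_sum]
  simp only [frameCoord, _root_.sum_apply, ContinuousLinearMap.smulRight_apply,
    ContinuousLinearMap.proj_apply]
  exact Finset.sum_congr rfl fun i _ ↦ (map_smul _ _ _).symm

lemma frameCoord_extChartAt {x : B} (hx : x ∈ (chartAt F c).source) (a : Fin k → ℝ) :
    frameCoord X c (extChartAt 𝓘(ℝ, F) c x) a = coordVec c x (∑ i, a i • X i x) := by
  have hx' : (extChartAt 𝓘(ℝ, F) c).symm (extChartAt 𝓘(ℝ, F) c x) = x :=
    (extChartAt 𝓘(ℝ, F) c).left_inv (by simpa using hx)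
  rw [frameCoord_apply]
  have h : ∀ x', x' = x → coordVec c x' (∑ i, a i • X i x') = coordVec c x (∑ i, a i • X i x) := by
    rintro x' rfl
    rfl
  exact h _ hx'

lemma differentiableAt_frameCoord {O : Set B} (hO : IsOpen O) (hX : ∀ i, SmoothFieldOn (X i) O)
    {y : F} (hy : y ∈ (extChartAt 𝓘(ℝ, F) c).target) (hyO : (extChartAt 𝓘(ℝ, F) c).symm y ∈ O) :
    DifferentiableAt ℝ (frameCoord X c) y := by
  have h : ∀ i, DifferentiableAt ℝ (fun y ↦
      coordVec c ((extChartAt 𝓘(ℝ, F) c).symm y) (X i ((extChartAt 𝓘(ℝ, F) c).symm y))) y :=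
    fun i ↦ ((hX i).contDiffAt_coordVec hO hy hyO).differentiableAt (by simp)
  unfold frameCoord
  refine DifferentiableAt.fun_sum fun i _ ↦ ?_
  exact ((ContinuousLinearMap.smulRightL ℝ (Fin k → ℝ) F
    (ContinuousLinearMap.proj i)).differentiableAt).comp y (h i)

variable [RiemannianBundle (fun x : B ↦ TangentSpace 𝓘(ℝ, F) x)]
  [IsContMDiffRiemannianBundle 𝓘(ℝ, F) ∞ F (fun x : B ↦ TangentSpace 𝓘(ℝ, F) x)]

/-- The infinitesimal form of Clairaut's relation for a geodesic leaving `b` with velocity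
`W + u`. -/
lemma metricForm_covDeriv_eq_of_clairaut {h : B → ℝ} {b : B}
    (hh : ContMDiff 𝓘(ℝ, F) 𝓘(ℝ, ℝ) ∞ h)
    {D : ∀ b : B, Submodule ℝ (TangentSpace 𝓘(ℝ, F) b)} {U O : Set B} (hU : IsOpen U)
    (hO : IsOpen O) (hbU : b ∈ U) (hbO : b ∈ O) (hX : ∀ i, SmoothFieldOn (X i) O)
    (hXD : ∀ x ∈ O, ∀ i, X i x ∈ D x)
    (hC : ∀ (Ω : ℝ → B) (J : Set ℝ), IsOpen J → J.OrdConnected → MapsTo Ω J U →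
      IsGeodesicOn (F := F) Ω J →
      ∃ C : ℝ, ∀ s ∈ J, ∀ X ∈ D (Ω s), ∀ V ∈ (D (Ω s))ᗮ, velocity (F := F) Ω s = X + V →
        Real.exp (h (Ω s)) * Real.sin (InnerProductGeometry.angle (velocity (F := F) Ω s) V) = C)
    (a : Fin k → ℝ) {u : TangentSpace 𝓘(ℝ, F) b} (hu : u ∈ (D b)ᗮ) :
    metricForm b (extChartAt 𝓘(ℝ, F) b b)
      (fderiv ℝ (fun y ↦ frameCoord X b y a) (extChartAt 𝓘(ℝ, F) b b)
          (frameCoord X b (extChartAt 𝓘(ℝ, F) b b) a + coordVec b b u) +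
        flatChristoffel (metricForm b) (extChartAt 𝓘(ℝ, F) b b)
          (frameCoord X b (extChartAt 𝓘(ℝ, F) b b) a + coordVec b b u)
          (frameCoord X b (extChartAt 𝓘(ℝ, F) b b) a)) (coordVec b b u) =
      -(metricForm b (extChartAt 𝓘(ℝ, F) b b) (frameCoord X b (extChartAt 𝓘(ℝ, F) b b) a)
          (frameCoord X b (extChartAt 𝓘(ℝ, F) b b) a) *
        mvfderiv 𝓘(ℝ, F) h b (∑ i, a i • X i b + u)) := by
  have hb := mem_chart_source F b
  have hy := mem_extChartAt_target (I := 𝓘(ℝ, F)) b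
  have hXa : ∀ x ∈ O, ∑ i, a i • X i x ∈ D x := fun x hx ↦
    Submodule.sum_mem _ fun i _ ↦ Submodule.smul_mem _ _ (hXD x hx i)
  obtain ⟨ε, hε, γ, σ, hγ0, hσ0, hγσ⟩ := exists_geodesic_coord b
    (frameCoord X b (extChartAt 𝓘(ℝ, F) b b) a + coordVec b b u) (hU.inter hO) ⟨hbU, hbO⟩
  have h0 : (0 : ℝ) ∈ Ioo (-ε) ε := ⟨by linarith, hε⟩
  have hJ : IsOpen (Ioo (-ε) ε) := isOpen_Ioo
  have hγ1 : ∀ s ∈ Ioo (-ε) ε, γ s ∈ (extChartAt 𝓘(ℝ, F) b).target ∧ HasDerivAt γ (σ s) s :=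
    fun s hs ↦ ⟨(hγσ s hs).1, (hγσ s hs).2.2.1⟩
  obtain ⟨C, hC⟩ := hC (fun t ↦ (extChartAt 𝓘(ℝ, F) b).symm (γ t)) (Ioo (-ε) ε) hJ
    ordConnected_Ioo (fun s hs ↦ (hγσ s hs).2.1.1)
    (isGeodesicOn_of_coord hJ hγ1 fun s hs ↦ (hγσ s hs).2.2.2)
  have hexp : ∀ t : ℝ, (Real.exp t ^ 2)⁻¹ = Real.exp (-2 * t) := fun t ↦ by
    rw [← Real.exp_nat_mul, ← Real.exp_neg]; congr 1; push_cast; ring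
  have hγX : ∀ s ∈ Ioo (-ε) ε, ∀ v w : TangentSpace 𝓘(ℝ, F) ((extChartAt 𝓘(ℝ, F) b).symm (γ s)),
      (inner ℝ v w : ℝ) = metricForm b (γ s) (coordVec b _ v) (coordVec b _ w) := by
    intro s hs v w
    rw [inner_eq_metricForm
      (by simpa using (extChartAt 𝓘(ℝ, F) b).map_target (hγ1 s hs).1) v w,
      (extChartAt 𝓘(ℝ, F) b).right_inv (hγ1 s hs).1]
  have hvel := fun s hs ↦ coordVec_velocity hJ hγ1 (s := s) hs
  have hhd : DifferentiableAt ℝ (fun y ↦ h ((extChartAt 𝓘(ℝ, F) b).symm y))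
      (extChartAt 𝓘(ℝ, F) b b) := by
    have h1 : ContMDiffAt 𝓘(ℝ, F) 𝓘(ℝ, F) ∞ (extChartAt 𝓘(ℝ, F) b).symm
        (extChartAt 𝓘(ℝ, F) b b) :=
      ((contMDiffOn_extChartAt_symm b) _ hy).contMDiffAt ((isOpen_extChartAt_target b).mem_nhds hy)
    exact ((hh.contMDiffAt.comp _ h1).contDiffAt).differentiableAt (by simp)
  have hXu : metricForm b (extChartAt 𝓘(ℝ, F) b b) (frameCoord X b (extChartAt 𝓘(ℝ, F) b b) a)
      (coordVec b b u) = 0 := by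
    rw [frameCoord_extChartAt hb, ← inner_eq_metricForm hb]
    exact (D b).inner_right_of_mem_orthogonal (hXa b hbO) hu
  have hvu : coordVec b b (∑ i, a i • X i b + u) =
      frameCoord X b (extChartAt 𝓘(ℝ, F) b b) a + coordVec b b u := by
    rw [frameCoord_extChartAt hb, map_add]
  rw [mvfderiv_eq_fderiv_coordVec hb hhd, hvu]
  refine bilin_covDeriv_eq_of_clairaut (γ := γ) (σ := σ) (K := C ^ 2)
    (X := fun y ↦ frameCoord X b y a)
    (differentiableAt_metricForm hy) (metricForm_symm b)
    (fun u hu ↦ metricForm_self_pos hy hu)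
    ((differentiableAt_frameCoord hO hX hy (by rwa [extChartAt_to_inv])).clm_apply
      (differentiableAt_const a)) hhd hγ0 hσ0 hXu
    (by have := (hγ1 0 h0).2; rwa [hσ0] at this)
    (by have := (hγσ 0 h0).2.2.2; rwa [hγ0, hσ0] at this) ?_ ?_
  -- Near time 0: the inequality for the section ∑ aᵢ Xᵢ of `D`.
  · filter_upwards [hJ.mem_nhds h0] with s hs
    have : FiniteDimensional ℝ (TangentSpace 𝓘(ℝ, F) ((extChartAt 𝓘(ℝ, F) b).symm (γ s))) :=
      inferInstanceAs (FiniteDimensional ℝ F)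
    have h1 := two_mul_inner_sub_le_of_sin_angle (Real.exp_pos _) (hC s hs)
      (hXa _ (hγσ s hs).2.1.2)
    rw [hexp, hγX s hs, hγX s hs, hγX s hs, hvel s hs, ← frameCoord_apply] at h1
    exact h1
  -- At time 0 the section is exactly the `D`-component of the velocity, which gives equality.
  · have hx : ∀ x, x = b → ∀ v : TangentSpace 𝓘(ℝ, F) x,
        coordVec b x v = coordVec b b (∑ i, a i • X i b + u) →
        (∀ X ∈ D x, ∀ V ∈ (D x)ᗮ, v = X + V →
          Real.exp (h x) * Real.sin (InnerProductGeometry.angle v V) = C) →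
        (inner ℝ (∑ i, a i • X i b) (∑ i, a i • X i b) : ℝ) = C ^ 2 * (Real.exp (h b) ^ 2)⁻¹ *
          inner ℝ (∑ i, a i • X i b + u) (∑ i, a i • X i b + u) := by
      rintro x rfl v hv hv'
      have hv2 : v = ∑ i, a i • X i x + u := by
        rw [← ofCoordVec_coordVec hb v, hv, ofCoordVec_coordVec hb]
      rw [← hv2]
      exact inner_self_eq_of_sin_angle (Real.exp_pos _) (hXa x hbO) hu hv2
        (hv' _ (hXa x hbO) _ hu hv2)
    have h1 := hx _ (by rw [hγ0, extChartAt_to_inv]) _ (by rw [hvel 0 h0, hσ0, hvu]) (hC 0 h0)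
    rw [inner_eq_metricForm hb, inner_eq_metricForm hb, hvu, ← frameCoord_extChartAt hb, hexp] at h1
    rw [h1, extChartAt_to_inv]

end Frames

/-! ### Linearity of Christoffel symbols and polarization of the Hessian. -/

section FlatCalculus

variable {F : Type*} [NormedAddCommGroup F] [NormedSpace ℝ F] [FiniteDimensional ℝ F]
  {G : F → F →L[ℝ] F →L[ℝ] ℝ}

lemma bilin_flatChristoffel_add_left {y : F} (hs : ∀ y v w, G y v w = G y w v)
    (hpos : ∀ u, u ≠ 0 → 0 < G y u u) (u u' v w : F) :
    G y (flatChristoffel G y (u + u') v) w =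
      G y (flatChristoffel G y u v) w + G y (flatChristoffel G y u' v) w := by
  rw [bilin_flatChristoffel hs hpos, bilin_flatChristoffel hs hpos, bilin_flatChristoffel hs hpos]
  simp only [flatChristoffelFirst, map_add, _root_.add_apply]
  ring

lemma bilin_flatChristoffel_neg_left {y : F} (hs : ∀ y v w, G y v w = G y w v)
    (hpos : ∀ u, u ≠ 0 → 0 < G y u u) (u v w : F) :
    G y (flatChristoffel G y (-u) v) w = -G y (flatChristoffel G y u v) w := by
  rw [bilin_flatChristoffel hs hpos, bilin_flatChristoffel hs hpos]
  simp only [flatChristoffelFirst, map_neg, _root_.neg_apply]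
  ring

lemma bilin_flatHessian_add_self {E : Type*} [NormedAddCommGroup E] [NormedSpace ℝ E] {f : E → F}
    {x : E} (hf : ContDiffAt ℝ 2 f x) (hG : DifferentiableAt ℝ G (f x))
    (hs : ∀ y v w, G y v w = G y w v) (hpos : ∀ u, u ≠ 0 → 0 < G (f x) u u) (w z : E) (u : F) :
    G (f x) (flatHessian G f x (w + z) (w + z)) u = G (f x) (flatHessian G f x w w) u +
      2 * G (f x) (flatHessian G f x w z) u + G (f x) (flatHessian G f x z z) u := by
  have hl : ∀ w w' z, G (f x) (flatHessian G f x (w + w') z) u =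
      G (f x) (flatHessian G f x w z) u + G (f x) (flatHessian G f x w' z) u := by
    intro w w' z
    simp only [flatHessian, map_add, _root_.add_apply, bilin_flatChristoffel_add_left hs hpos]
    ring
  rw [hl, flatHessian_symm hf hG hs w (w + z), flatHessian_symm hf hG hs z (w + z), hl, hl,
    flatHessian_symm hf hG hs z w]
  ring

end FlatCalculus

/-! ### The Hessian of the map tested on normal vectors. -/

section RiemannianMapHessian

variable {E : Type*} [NormedAddCommGroup E] [NormedSpace ℝ E] [FiniteDimensional ℝ E]
  {M : Type*} [TopologicalSpace M] [ChartedSpace E M] [IsManifold 𝓘(ℝ, E) ∞ M]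
  {F : Type*} [NormedAddCommGroup F] [NormedSpace ℝ F] [FiniteDimensional ℝ F]
  {B : Type*} [TopologicalSpace B] [ChartedSpace F B] [IsManifold 𝓘(ℝ, F) ∞ B]
  {f : M → B}

lemma mem_chart_source_of_mem_target {p : M} {x : E} (hx : x ∈ (extChartAt 𝓘(ℝ, E) p).target) :
    (extChartAt 𝓘(ℝ, E) p).symm x ∈ (chartAt E p).source := by
  simpa using (extChartAt 𝓘(ℝ, E) p).map_target hx

lemma fderiv_coordRep (hf : ContMDiff 𝓘(ℝ, E) 𝓘(ℝ, F) ∞ f) {p : M} {x : E}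
    (hx : x ∈ (extChartAt 𝓘(ℝ, E) p).target)
    (hfx : f ((extChartAt 𝓘(ℝ, E) p).symm x) ∈ (chartAt F (f p)).source) (z : E) :
    fderiv ℝ (coordRep (E := E) (F := F) f p) x z =
      coordVec (f p) (f ((extChartAt 𝓘(ℝ, E) p).symm x))
        (pushforward (E := E) (F := F) f ((extChartAt 𝓘(ℝ, E) p).symm x) (ofCoordVec p _ z)) := by
  have hs := mem_chart_source_of_mem_target hx
  rw [coordVec_pushforward hf hs hfx, coordVec_ofCoordVec hs, (extChartAt 𝓘(ℝ, E) p).right_inv hx]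

variable [RiemannianBundle (fun x : B ↦ TangentSpace 𝓘(ℝ, F) x)]
  [IsContMDiffRiemannianBundle 𝓘(ℝ, F) ∞ F (fun x : B ↦ TangentSpace 𝓘(ℝ, F) x)]

/-- The Hessian `∇^f_w (f_* Z)`, in the chart centred at `f p`. -/
def hessianCoord (f : M → B) (p : M) (w z : TangentSpace 𝓘(ℝ, E) p) : F :=
  flatHessian (metricForm (f p)) (coordRep (E := E) (F := F) f p) (extChartAt 𝓘(ℝ, E) p p)
    (coordVec p p w) (coordVec p p z)

/-- Transfer of `bilin_flatHessian_symm` to manifolds. The horizontal Reeb field serves twice: η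
vanishes on the range, and ξ is orthogonal to it, which together remove ∇ψ. -/
lemma metricForm_hessianCoord_symm {S : AlmostContactMetric F B} {α β : B → ℝ}
    (hS : S.IsTransSasakian α β) (hf : ContMDiff 𝓘(ℝ, E) 𝓘(ℝ, F) ∞ f)
    (hanti : IsAntiInvariant (E := E) S f) (hξ : HasHorizontalReeb (E := E) S f) (p : M)
    (w z z' : TangentSpace 𝓘(ℝ, E) p) :
    metricForm (f p) (extChartAt 𝓘(ℝ, F) (f p) (f p)) (hessianCoord f p w z)
        (coordVec (f p) (f p) (S.ψ (f p) (pushforward f p z'))) =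
      metricForm (f p) (extChartAt 𝓘(ℝ, F) (f p) (f p)) (hessianCoord f p w z')
        (coordVec (f p) (f p) (S.ψ (f p) (pushforward f p z))) := by
  have hp := mem_chart_source E p
  have hb := mem_chart_source F (f p)
  have hy := mem_extChartAt_target (I := 𝓘(ℝ, F)) (f p)
  have hpush : ∀ v : TangentSpace 𝓘(ℝ, E) p, fderiv ℝ (coordRep (E := E) (F := F) f p)
      (extChartAt 𝓘(ℝ, E) p p) (coordVec p p v) = coordVec (f p) (f p) (pushforward f p v) :=
    fun v ↦ (coordVec_pushforward hf hp hb v).symm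
  have hrange : ∀ (q : M) (v : TangentSpace 𝓘(ℝ, E) q),
      pushforward (E := E) (F := F) f q v ∈ rangeAt (E := E) (F := F) f q := fun q v ↦ ⟨v, rfl⟩
  have hsurj : ∀ v : E, ∃ v' : TangentSpace 𝓘(ℝ, E) p, v = coordVec p p v' :=
    fun v ↦ ⟨_, (coordVec_ofCoordVec hp v).symm⟩
  have hsurjB : ∀ v : F, ∃ v' : TangentSpace 𝓘(ℝ, F) (f p), v = coordVec (f p) (f p) v' :=
    fun v ↦ ⟨_, (coordVec_ofCoordVec hb v).symm⟩
  have key := bilin_flatHessian_symm (G := metricForm (f p))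
    (f := coordRep (E := E) (F := F) f p) (x := extChartAt 𝓘(ℝ, E) p p) (Ψ := S.ψCoord (f p))
    ((contDiffAt_coordRep_self hf p).of_le two_le_infty)
    (by rw [coordRep_self]; exact differentiableAt_metricForm hy)
    (metricForm_symm (f p))
    (by rw [coordRep_self]; exact fun u hu ↦ metricForm_self_pos hy hu)
    (by rw [coordRep_self]; exact S.differentiableAt_ψCoord hy)
    (by
      filter_upwards [eventually_mem_charts hf p] with x ⟨hx, hfx⟩ z w
      rw [fderiv_coordRep hf hx hfx, fderiv_coordRep hf hx hfx, coordRep,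
        S.ψCoord_coordVec hfx, ← inner_eq_metricForm hfx]
      exact Submodule.inner_left_of_mem_orthogonal (hrange _ _) (hanti _ _ (hrange _ _)))
    (by
      intro u v
      obtain ⟨u, rfl⟩ := hsurjB u
      obtain ⟨v, rfl⟩ := hsurjB v
      rw [coordRep_self, S.ψCoord_coordVec hb, S.ψCoord_coordVec hb, ← inner_eq_metricForm hb,
        ← inner_eq_metricForm hb]
      exact S.inner_ψ _ _ _)
    (by
      intro w z x
      obtain ⟨w, rfl⟩ := hsurj w
      obtain ⟨z, rfl⟩ := hsurj z
      obtain ⟨x, rfl⟩ := hsurj x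
      rw [hpush, hpush, hpush, coordRep_self]
      refine hS.metricForm_eq_zero _ _ _ ?_ ?_
      · rw [S.η_eq]
        exact Submodule.inner_right_of_mem_orthogonal (hrange _ _) (hξ p)
      · exact Submodule.inner_left_of_mem_orthogonal (hrange _ _) (hξ p))
    (coordVec p p w) (coordVec p p z) (coordVec p p z')
  rw [hpush, hpush, coordRep_self, S.ψCoord_coordVec hb, S.ψCoord_coordVec hb] at key
  exact key

section Clairaut

/-- The Hessian of a map of manifolds, tested on vectors orthogonal to the range, is determined by
the infinitesimal Clairaut relation. -/
lemma metricForm_hessianCoord_of_isClairautMap {h : B → ℝ}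
    (hf : ContMDiff 𝓘(ℝ, E) 𝓘(ℝ, F) ∞ f) (hh : ContMDiff 𝓘(ℝ, F) 𝓘(ℝ, ℝ) ∞ h)
    (hC : IsClairautMap (E := E) (F := F) f (fun b ↦ Real.exp (h b))) (p : M)
    (w z : TangentSpace 𝓘(ℝ, E) p) {u : TangentSpace 𝓘(ℝ, F) (f p)}
    (hu : u ∈ (rangeAt (E := E) (F := F) f p)ᗮ) :
    metricForm (f p) (extChartAt 𝓘(ℝ, F) (f p) (f p)) (hessianCoord f p w z)
        (coordVec (f p) (f p) u) =
      -((inner ℝ (pushforward (E := E) (F := F) f p w) (pushforward f p z) : ℝ) *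
        mvfderiv 𝓘(ℝ, F) h (f p) u) := by
  have hp := mem_chart_source E p
  have hb := mem_chart_source F (f p)
  have hy := mem_extChartAt_target (I := 𝓘(ℝ, F)) (f p)
  have hpush : ∀ v : TangentSpace 𝓘(ℝ, E) p, fderiv ℝ (coordRep (E := E) (F := F) f p)
      (extChartAt 𝓘(ℝ, E) p p) (coordVec p p v) = coordVec (f p) (f p) (pushforward f p v) :=
    fun v ↦ (coordVec_pushforward hf hp hb v).symm
  have hcd := (contDiffAt_coordRep_self hf p).of_le two_le_infty
  have hd1 : DifferentiableAt ℝ (coordRep (E := E) (F := F) f p) (extChartAt 𝓘(ℝ, E) p p) :=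
    hcd.differentiableAt (by simp)
  have hd2 : DifferentiableAt ℝ (fderiv ℝ (coordRep (E := E) (F := F) f p))
      (extChartAt 𝓘(ℝ, E) p p) :=
    (hcd.fderiv_right (m := 1) (by norm_num)).differentiableAt (by simp)
  have hyp : ∀ v, v ≠ 0 → 0 < metricForm (f p) (extChartAt 𝓘(ℝ, F) (f p) (f p)) v v :=
    fun v hv ↦ metricForm_self_pos hy hv
  obtain ⟨-, U, D, hU, hfU, hD, hDf, hgeo⟩ := hC
  obtain ⟨O, hO, hbO, k, X, hX, hXD⟩ := hD (f p) (hfU p)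
  have hmemD : ∀ x ∈ O, ∀ i, X i x ∈ D x := fun x hx i ↦ by
    rw [← (hXD x hx).2]; exact Submodule.subset_span ⟨i, rfl⟩
  have hcoeff : ∀ x ∈ O, x ∈ (chartAt F (f p)).source → ∀ v ∈ D x, ∃ a,
      coordVec (f p) x v = frameCoord X (f p) (extChartAt 𝓘(ℝ, F) (f p) x) a := by
    intro x hx hxs v hv
    rw [← (hXD x hx).2, Submodule.mem_span_range_iff_exists_fun] at hv
    obtain ⟨a, rfl⟩ := hv
    exact ⟨a, (frameCoord_extChartAt hxs a).symm⟩
  have hTd : DifferentiableAt ℝ (frameCoord X (f p)) (extChartAt 𝓘(ℝ, F) (f p) (f p)) :=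
    differentiableAt_frameCoord hO hX hy (by rwa [extChartAt_to_inv])
  have hTinj : Function.Injective (frameCoord X (f p) (extChartAt 𝓘(ℝ, F) (f p) (f p))) := by
    intro a a' haa
    rw [frameCoord_extChartAt hb, frameCoord_extChartAt hb] at haa
    have h1 := congrArg (ofCoordVec (f p) (f p)) haa
    rw [ofCoordVec_coordVec hb, ofCoordVec_coordVec hb] at h1
    have h2 := linearIndependent_iff_injective_fintypeLinearCombination.1 (hXD _ hbO).1
    exact h2 (by simpa [Fintype.linearCombination_apply] using h1)
  have hu' : u ∈ (D (f p))ᗮ := by rwa [hDf]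
  -- The Clairaut relation is quadratic in the `D`-component, so it first determines the diagonal of
  -- the Hessian.
  have hdiag : ∀ w : TangentSpace 𝓘(ℝ, E) p,
      metricForm (f p) (extChartAt 𝓘(ℝ, F) (f p) (f p)) (hessianCoord f p w w)
          (coordVec (f p) (f p) u) =
        -((inner ℝ (pushforward (E := E) (F := F) f p w) (pushforward f p w) : ℝ) *
          mvfderiv 𝓘(ℝ, F) h (f p) u) := by
    intro w
    obtain ⟨a, ha⟩ := hcoeff (f p) hbO hb (pushforward f p w) (by rw [hDf]; exact ⟨w, rfl⟩)
    have h1 := metricForm_covDeriv_eq_of_clairaut hh hU hO (hfU p) hbO hX hmemD hgeo a hu'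
    -- The geodesic with velocity W - u: subtracting its relation from that of W + u cancels the
    -- unwanted terms with ∇_u X and dh(W).
    have h2 := metricForm_covDeriv_eq_of_clairaut hh hU hO (hfU p) hbO hX hmemD hgeo a
      (neg_mem hu')
    rw [frameCoord_extChartAt hb] at ha
    have hW : ∑ i, a i • X i (f p) = pushforward f p w := by
      rw [← ofCoordVec_coordVec hb (pushforward f p w), ha, ofCoordVec_coordVec hb]
    rw [frameCoord_extChartAt hb, hW] at h1 h2
    rw [map_neg] at h2
    simp only [map_add, map_neg, _root_.add_apply, _root_.neg_apply,
      bilin_flatChristoffel_add_left (metricForm_symm _) hyp,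
      bilin_flatChristoffel_neg_left (metricForm_symm _) hyp] at h1 h2
    set c := metricForm (f p) (extChartAt 𝓘(ℝ, F) (f p) (f p))
      (coordVec (f p) (f p) (pushforward f p w)) (coordVec (f p) (f p) (pushforward f p w)) with hc
    have hT : HasFDerivAt (fun x ↦ frameCoord X (f p) (coordRep (E := E) (F := F) f p x))
        ((fderiv ℝ (frameCoord X (f p)) (extChartAt 𝓘(ℝ, F) (f p) (f p))).comp
          (fderiv ℝ (coordRep (E := E) (F := F) f p) (extChartAt 𝓘(ℝ, E) p p)))
        (extChartAt 𝓘(ℝ, E) p p) :=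
      HasFDerivAt.comp (g := frameCoord X (f p)) _
        (by rw [coordRep_self]; exact hTd.hasFDerivAt) hd1.hasFDerivAt
    -- The field f_*w - X∘f along f takes values in `D` and vanishes at p, so its derivative there
    -- lies in `D` and is invisible to u. Thus f_*w may be replaced by the section X.
    have hY := (hd2.hasFDerivAt.clm_apply (hasFDerivAt_const (𝕜 := ℝ) (coordVec p p w)
      (extChartAt 𝓘(ℝ, E) p p))).fun_sub (hT.clm_apply (hasFDerivAt_const (𝕜 := ℝ) a
      (extChartAt 𝓘(ℝ, E) p p)))
    have hTa : fderiv ℝ (fun y ↦ frameCoord X (f p) y a) (extChartAt 𝓘(ℝ, F) (f p) (f p))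
        (coordVec (f p) (f p) (pushforward f p w)) =
        fderiv ℝ (frameCoord X (f p)) (extChartAt 𝓘(ℝ, F) (f p) (f p))
          (coordVec (f p) (f p) (pushforward f p w)) a := by
      rw [(hTd.hasFDerivAt.clm_apply (hasFDerivAt_const (𝕜 := ℝ) a
        (extChartAt 𝓘(ℝ, F) (f p) (f p)))).fderiv]
      simp
    obtain ⟨a', ha'⟩ := fderiv_mem_range_of_eventually_mem_range hT.differentiableAt
      (by rwa [coordRep_self]) hY.differentiableAt
      (by
        have hfO : ∀ᶠ x in 𝓝 (extChartAt 𝓘(ℝ, E) p p), f ((extChartAt 𝓘(ℝ, E) p).symm x) ∈ O := by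
          have h1 : ContinuousAt (fun x ↦ f ((extChartAt 𝓘(ℝ, E) p).symm x))
            (extChartAt 𝓘(ℝ, E) p p) :=
            hf.continuous.continuousAt.comp (continuousAt_extChartAt_symm p)
          refine h1.eventually_mem (hO.mem_nhds ?_)
          rwa [extChartAt_to_inv]
        filter_upwards [eventually_mem_charts hf p, hfO] with x ⟨hx, hfx⟩ hxO
        obtain ⟨d, hd⟩ := hcoeff _ hxO hfx
          (pushforward (E := E) (F := F) f ((extChartAt 𝓘(ℝ, E) p).symm x)
            (ofCoordVec p _ (coordVec p p w))) (by rw [hDf]; exact ⟨_, rfl⟩)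
        refine ⟨d - a, ?_⟩
        rw [map_sub]
        refine congrArg₂ _ ?_ rfl
        rw [fderiv_coordRep hf hx hfx]
        exact hd)
      (by
        rw [hpush, coordRep_self, frameCoord_extChartAt hb, hW, sub_self])
      (coordVec p p w)
    rw [hY.fderiv, coordRep_self, frameCoord_extChartAt hb] at ha'
    have hperp : metricForm (f p) (extChartAt 𝓘(ℝ, F) (f p) (f p))
        (coordVec (f p) (f p) (∑ i, a' i • X i (f p))) (coordVec (f p) (f p) u) = 0 := by
      rw [← inner_eq_metricForm hb]
      exact Submodule.inner_right_of_mem_orthogonal (Submodule.sum_mem _ fun i _ ↦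
        Submodule.smul_mem _ _ (hmemD _ hbO i)) hu'
    rw [← ha'] at hperp
    simp only [ContinuousLinearMap.comp_zero, zero_add, _root_.sub_apply,
      ContinuousLinearMap.flip_apply, ContinuousLinearMap.comp_apply, map_sub, hpush] at hperp
    rw [hTa] at h1 h2
    rw [inner_eq_metricForm hb, ← hc, hessianCoord, flatHessian, coordRep_self, hpush, map_add,
      _root_.add_apply]
    linarith
  -- Polarization passes from the diagonal to all pairs w, z.
  have hpol := bilin_flatHessian_add_self hcd
    (by rw [coordRep_self]; exact differentiableAt_metricForm hy) (metricForm_symm (f p))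
    (by rwa [coordRep_self]) (coordVec p p w) (coordVec p p z) (coordVec (f p) (f p) u)
  have e1 := hdiag (w + z)
  have e2 := hdiag w
  have e3 := hdiag z
  simp only [hessianCoord, map_add, inner_add_left, inner_add_right] at e1 e2 e3 ⊢
  rw [coordRep_self] at hpol
  rw [real_inner_comm (pushforward f p w) (pushforward f p z)] at e1
  linarith

/-- The second fundamental form, tested on vectors orthogonal to the range. -/
lemma inner_secondFundamentalForm [RiemannianBundle (fun x : M ↦ TangentSpace 𝓘(ℝ, E) x)]
    (hf : ContMDiff 𝓘(ℝ, E) 𝓘(ℝ, F) ∞ f) (p : M)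
    (w z : TangentSpace 𝓘(ℝ, E) p) {u : TangentSpace 𝓘(ℝ, F) (f p)}
    (hu : u ∈ (rangeAt (E := E) (F := F) f p)ᗮ) :
    (inner ℝ (secondFundamentalForm (E := E) (F := F) f p w z) u : ℝ) =
      metricForm (f p) (extChartAt 𝓘(ℝ, F) (f p) (f p)) (hessianCoord f p w z)
        (coordVec (f p) (f p) u) := by
  have hb := mem_chart_source F (f p)
  unfold secondFundamentalForm
  rw [inner_sub_left, inner_eq_metricForm hb, coordVec_covDerivAlong_pushforward hf p w z,
    show (inner ℝ (pushforward (E := E) (F := F) f p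
      (leviCivita (FiberBundle.extend E z) p w)) u : ℝ) = 0 from Submodule.inner_right_of_mem_orthogonal (K := rangeAt (E := E) (F := F) f p)
        ⟨_, rfl⟩ hu, sub_zero]
  rfl

end Clairaut

end RiemannianMapHessian

/-! ### The pointwise alternative. -/

section ClairautRiemannianMaps

variable {E : Type*} [NormedAddCommGroup E] [NormedSpace ℝ E] [FiniteDimensional ℝ E]
  {M : Type*} [TopologicalSpace M] [ChartedSpace E M] [IsManifold 𝓘(ℝ, E) ∞ M]
  [RiemannianBundle (fun x : M ↦ TangentSpace 𝓘(ℝ, E) x)]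
  {F : Type*} [NormedAddCommGroup F] [NormedSpace ℝ F] [FiniteDimensional ℝ F]
  {B : Type*} [TopologicalSpace B] [ChartedSpace F B] [IsManifold 𝓘(ℝ, F) ∞ B]
  [RiemannianBundle (fun x : B ↦ TangentSpace 𝓘(ℝ, F) x)]
  {f : M → B}

lemma exists_horizontal_pushforward_eq (p : M) {v : TangentSpace 𝓘(ℝ, F) (f p)}
    (hv : v ∈ rangeAt (E := E) (F := F) f p) :
    ∃ w ∈ horizontalAt (E := E) (F := F) f p, pushforward (E := E) (F := F) f p w = v := by
  have : FiniteDimensional ℝ (TangentSpace 𝓘(ℝ, E) p) := inferInstanceAs (FiniteDimensional ℝ E)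
  obtain ⟨w, rfl⟩ := hv
  obtain ⟨k, hk, z, hz, hw⟩ :=
    (pushforward (E := E) (F := F) f p).toLinearMap.ker.exists_add_mem_mem_orthogonal w
  refine ⟨z, hz, ?_⟩
  rw [hw, map_add]
  have : (pushforward (E := E) (F := F) f p).toLinearMap k = 0 := hk
  rw [this, zero_add]
  rfl

/-- A form `φ` with `⟪w, z⟫ φ x = ⟪w, x⟫ φ z` vanishes in dimension other than one. -/
lemma eq_zero_of_inner_mul_eq {V : Type*} [NormedAddCommGroup V] [InnerProductSpace ℝ V]
    {D : Submodule ℝ V} [FiniteDimensional ℝ D] {φ : V → ℝ} (hφ : φ 0 = 0)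
    (h : ∀ w ∈ D, ∀ z ∈ D, ∀ x ∈ D, (inner ℝ w z : ℝ) * φ x = inner ℝ w x * φ z)
    (hD : Module.finrank ℝ D ≠ 1) {x : V} (hx : x ∈ D) : φ x = 0 := by
  rcases eq_or_ne x 0 with rfl | hx0
  · exact hφ
  · have h1 : ∃ z ∈ D, z ∉ Submodule.span ℝ {x} := by
      by_contra! h2
      refine hD ?_
      have : D = Submodule.span ℝ {x} :=
        le_antisymm h2 ((Submodule.span_singleton_le_iff_mem x D).2 hx)
      rw [this, finrank_span_singleton hx0]
    obtain ⟨z, hz, hzx⟩ := h1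
    obtain ⟨a, ha, y, hy, rfl⟩ := (Submodule.span ℝ {x}).exists_add_mem_mem_orthogonal z
    have haD : a ∈ D := (Submodule.span_singleton_le_iff_mem x D).2 hx ha
    have hyD : y ∈ D := by simpa using D.sub_mem hz haD
    have hy0 : y ≠ 0 := by
      rintro rfl
      exact hzx (by simpa using ha)
    -- The choice w = z = y with y ⊥ x annihilates the right-hand side and leaves |y|² φ(x) = 0.
    have h2 := h y hyD y hyD x hx
    have h3 : (inner ℝ y x : ℝ) = 0 :=
      Submodule.inner_left_of_mem_orthogonal (Submodule.mem_span_singleton_self x) hy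
    rw [h3, zero_mul] at h2
    exact (mul_eq_zero.1 h2).resolve_left (inner_self_ne_zero.2 hy0)

variable [IsContMDiffRiemannianBundle 𝓘(ℝ, F) ∞ F (fun x : B ↦ TangentSpace 𝓘(ℝ, F) x)]

lemma finrank_rangeAt_eq_one_or_isConstantAlongAt {S : AlmostContactMetric F B} {α β : B → ℝ}
    (hS : S.IsTransSasakian α β) (hf : IsRiemannianMap (E := E) (F := F) f)
    (hanti : IsAntiInvariant (E := E) S f) (hξ : HasHorizontalReeb (E := E) S f)
    {h : B → ℝ} (hh : ContMDiff 𝓘(ℝ, F) 𝓘(ℝ, ℝ) ∞ h)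
    (hC : IsClairautMap (E := E) (F := F) f (fun b ↦ Real.exp (h b)) ∨
      IsClairautUmbilical (E := E) (F := F) f h) (p : M) :
    Module.finrank ℝ (rangeAt (E := E) (F := F) f p) = 1 ∨ IsConstantAlongAt (E := E) S f h p := by
  refine or_iff_not_imp_left.2 fun hrank v hv ↦ ?_
  have : FiniteDimensional ℝ (TangentSpace 𝓘(ℝ, F) (f p)) :=
    inferInstanceAs (FiniteDimensional ℝ F)
  -- The common consequence of the two Clairaut conditions; nothing after it depends on which one
  -- holds.
  have hH : ∀ w ∈ horizontalAt (E := E) (F := F) f p, ∀ z ∈ horizontalAt (E := E) (F := F) f p,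
      ∀ u ∈ (rangeAt (E := E) (F := F) f p)ᗮ,
      metricForm (f p) (extChartAt 𝓘(ℝ, F) (f p) (f p)) (hessianCoord f p w z)
        (coordVec (f p) (f p) u) =
      -((inner ℝ (pushforward (E := E) (F := F) f p w) (pushforward f p z) : ℝ) *
        mvfderiv 𝓘(ℝ, F) h (f p) u) := by
    intro w hw z hz u hu
    rcases hC with hC | hC
    · exact metricForm_hessianCoord_of_isClairautMap hf.1 hh hC p w z hu
    · rw [← inner_secondFundamentalForm hf.1 p w z hu, hC p w hw z hz u, hf.2 p w hw z hz]
  refine eq_zero_of_inner_mul_eq (D := rangeAt (E := E) (F := F) f p)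
    (φ := fun v ↦ mvfderiv 𝓘(ℝ, F) h (f p) (S.ψ (f p) v)) (by simp) ?_ hrank hv
  intro w hw z hz x hx
  obtain ⟨w, hw', rfl⟩ := exists_horizontal_pushforward_eq p hw
  obtain ⟨z, hz', rfl⟩ := exists_horizontal_pushforward_eq p hz
  obtain ⟨x, hx', rfl⟩ := exists_horizontal_pushforward_eq p hx
  have h1 := hH w hw' z hz' _ (hanti p (pushforward f p x) ⟨x, rfl⟩)
  have h2 := hH w hw' x hx' _ (hanti p (pushforward f p z) ⟨z, rfl⟩)
  have h3 := metricForm_hessianCoord_symm hS hf.1 hanti hξ p w z x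
  linarith

end ClairautRiemannianMaps

/-! ### Local constancy of the rank. -/

section LinearAlgebra

variable {V W : Type*} [NormedAddCommGroup V] [InnerProductSpace ℝ V]
  [NormedAddCommGroup W] [InnerProductSpace ℝ W]

/-- If `A` is isometric on `(ker A)ᗮ`, this subspace is the kernel of the difference of the two
inner products. -/
lemma mem_ker_orthogonal_iff_of_isometric {A : V →ₗ[ℝ] W} [A.ker.HasOrthogonalProjection]
    (hA : ∀ v ∈ A.kerᗮ, ∀ w ∈ A.kerᗮ, (inner ℝ (A v) (A w) : ℝ) = inner ℝ v w) (v : V) :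
    v ∈ A.kerᗮ ↔ ∀ w, (inner ℝ v w : ℝ) - inner ℝ (A v) (A w) = 0 := by
  have key : ∀ v ∈ A.kerᗮ, ∀ w, (inner ℝ (A v) (A w) : ℝ) = inner ℝ v w := by
    intro v hv w
    obtain ⟨k, hk, z, hz, rfl⟩ := A.ker.exists_add_mem_mem_orthogonal w
    rw [map_add, LinearMap.mem_ker.1 hk, zero_add, hA v hv z hz, inner_add_right,
      Submodule.inner_left_of_mem_orthogonal hk hv, zero_add]
  refine ⟨fun hv w ↦ sub_eq_zero.2 (key v hv w).symm, fun h ↦ ?_⟩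
  obtain ⟨k, hk, z, hz, rfl⟩ := A.ker.exists_add_mem_mem_orthogonal v
  -- Testing against the kernel component k of v leaves |k|² = 0.
  have h1 := h k
  rw [LinearMap.mem_ker.1 hk, inner_zero_right, sub_zero, inner_add_left,
    Submodule.inner_left_of_mem_orthogonal hk hz, add_zero, inner_self_eq_zero] at h1
  rw [h1, zero_add]
  exact hz

end LinearAlgebra

/-- Lower semicontinuity of the rank: operators of rank at least n form an open set. -/
lemma eventually_finrank_range_le {X : Type*} [TopologicalSpace X] {E F : Type*}
    [NormedAddCommGroup E] [NormedSpace ℝ E] [FiniteDimensional ℝ E]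
    [NormedAddCommGroup F] [NormedSpace ℝ F] {A : X → E →L[ℝ] F} {x : X} (hA : ContinuousAt A x) :
    ∀ᶠ y in 𝓝 x, Module.finrank ℝ (A x).toLinearMap.range ≤
      Module.finrank ℝ (A y).toLinearMap.range := by
  have h := hA.eventually_mem ((isOpen_setOfPred_nat_le_rank (𝕜 := ℝ) (E := E)
    (F := F) (Module.finrank ℝ (A x).toLinearMap.range)).mem_nhds (by
      simp [LinearMap.rank, Module.finrank_eq_rank]))
  filter_upwards [h] with y hy
  have hy' : ((Module.finrank ℝ (A x).toLinearMap.range : ℕ) : Cardinal) ≤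
    Module.rank ℝ (A y).toLinearMap.range := hy
  rw [← Module.finrank_eq_rank] at hy'
  exact_mod_cast hy'

section Rank

variable {E : Type*} [NormedAddCommGroup E] [NormedSpace ℝ E] [FiniteDimensional ℝ E]
  {M : Type*} [TopologicalSpace M] [ChartedSpace E M] [IsManifold 𝓘(ℝ, E) ∞ M]
  [RiemannianBundle (fun x : M ↦ TangentSpace 𝓘(ℝ, E) x)]
  {F : Type*} [NormedAddCommGroup F] [NormedSpace ℝ F] [FiniteDimensional ℝ F]
  {B : Type*} [TopologicalSpace B] [ChartedSpace F B] [IsManifold 𝓘(ℝ, F) ∞ B]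
  [RiemannianBundle (fun x : B ↦ TangentSpace 𝓘(ℝ, F) x)]
  {f : M → B}

lemma coordVec_injective {p q : M} (hq : q ∈ (chartAt E p).source) :
    Function.Injective (coordVec (F := E) p q) :=
  Function.LeftInverse.injective (ofCoordVec_coordVec hq)

/-- The difference of the metric of `M` and the metric pulled back from `B`, in charts. -/
def metricDefect (f : M → B) (p : M) (x : E) : E →L[ℝ] E →L[ℝ] ℝ :=
  metricForm p x - (metricForm (f p) (coordRep (E := E) (F := F) f p x)).bilinearComp
    (fderiv ℝ (coordRep (E := E) (F := F) f p) x) (fderiv ℝ (coordRep (E := E) (F := F) f p) x)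

lemma finrank_range_fderiv_coordRep (hf : ContMDiff 𝓘(ℝ, E) 𝓘(ℝ, F) ∞ f) {p q : M}
    (hq : q ∈ (chartAt E p).source) (hfq : f q ∈ (chartAt F (f p)).source) :
    Module.finrank ℝ (fderiv ℝ (coordRep (E := E) (F := F) f p)
      (extChartAt 𝓘(ℝ, E) p q)).toLinearMap.range =
      Module.finrank ℝ (rangeAt (E := E) (F := F) f q) := by
  have h : (fderiv ℝ (coordRep (E := E) (F := F) f p) (extChartAt 𝓘(ℝ, E) p q)).toLinearMap.range =
      (rangeAt (E := E) (F := F) f q).map (coordVec (f p) (f q)).toLinearMap := by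
    ext v
    constructor
    · rintro ⟨z, rfl⟩
      refine ⟨_, ⟨ofCoordVec p q z, rfl⟩, ?_⟩
      exact (coordVec_pushforward hf hq hfq _).trans (by rw [coordVec_ofCoordVec hq]; rfl)
    · rintro ⟨_, ⟨w, rfl⟩, rfl⟩
      exact ⟨coordVec p q w, (coordVec_pushforward hf hq hfq w).symm⟩
  rw [h]
  exact ((Submodule.equivMapOfInjective _ (coordVec_injective hfq) _).finrank_eq).symm

/-- The form g₁ - f^*g₂ has the horizontal space as its kernel, so its rank is dim ker f_*,
complementary to the rank of f. -/
lemma finrank_range_metricDefect (hf : IsRiemannianMap (E := E) (F := F) f) {p q : M}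
    (hq : q ∈ (chartAt E p).source) (hfq : f q ∈ (chartAt F (f p)).source) :
    Module.finrank ℝ (metricDefect (E := E) (F := F) f p (extChartAt 𝓘(ℝ, E) p q)).toLinearMap.range
      + Module.finrank ℝ (rangeAt (E := E) (F := F) f q) = Module.finrank ℝ E := by
  have : FiniteDimensional ℝ (TangentSpace 𝓘(ℝ, E) q) := inferInstanceAs (FiniteDimensional ℝ E)
  have happ : ∀ v w : TangentSpace 𝓘(ℝ, E) q,
      metricDefect (E := E) (F := F) f p (extChartAt 𝓘(ℝ, E) p q) (coordVec p q v)
          (coordVec p q w) =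
        (inner ℝ v w : ℝ) - inner ℝ (pushforward (E := E) (F := F) f q v) (pushforward f q w) := by
    intro v w
    rw [inner_eq_metricForm hq, inner_eq_metricForm hfq, coordVec_pushforward hf.1 hq hfq,
      coordVec_pushforward hf.1 hq hfq, ← coordRep_extChartAt (F := F) f hq]
    rfl
  have hker : (metricDefect (E := E) (F := F) f p (extChartAt 𝓘(ℝ, E) p q)).toLinearMap.ker =
      (horizontalAt (E := E) (F := F) f q).map (coordVec p q).toLinearMap := by
    ext z
    obtain ⟨v, rfl⟩ : ∃ v, z = coordVec p q v := ⟨_, (coordVec_ofCoordVec hq z).symm⟩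
    have h1 := mem_ker_orthogonal_iff_of_isometric
      (A := (pushforward (E := E) (F := F) f q).toLinearMap) (hf.2 q) v
    have h2 : coordVec p q v ∈ (horizontalAt (E := E) (F := F) f q).map
        (coordVec p q).toLinearMap ↔ v ∈ horizontalAt (E := E) (F := F) f q :=
      ⟨fun ⟨v', hv', e⟩ ↦ coordVec_injective hq e ▸ hv', fun hv ↦ ⟨v, hv, rfl⟩⟩
    rw [h2]
    refine Iff.trans ?_ h1.symm
    rw [LinearMap.mem_ker]
    constructor
    · intro h w
      refine (happ v w).symm.trans ?_
      exact DFunLike.congr_fun h (coordVec p q w)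
    · intro h
      ext z
      obtain ⟨w, rfl⟩ : ∃ w, z = coordVec p q w := ⟨_, (coordVec_ofCoordVec hq z).symm⟩
      exact (happ v w).trans (h w)
  have h1 := LinearMap.finrank_range_add_finrank_ker
    (metricDefect (E := E) (F := F) f p (extChartAt 𝓘(ℝ, E) p q)).toLinearMap
  have h2 := LinearMap.finrank_range_add_finrank_ker
    (pushforward (E := E) (F := F) f q).toLinearMap
  have h3 := Submodule.finrank_add_finrank_orthogonal
    (pushforward (E := E) (F := F) f q).toLinearMap.ker
  have h4 := (Submodule.equivMapOfInjective _ (coordVec_injective hq)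
    (horizontalAt (E := E) (F := F) f q)).finrank_eq
  rw [hker, ← h4] at h1
  unfold horizontalAt at h1
  unfold rangeAt
  omega

variable [IsContMDiffRiemannianBundle 𝓘(ℝ, E) ∞ E (fun x : M ↦ TangentSpace 𝓘(ℝ, E) x)]
  [IsContMDiffRiemannianBundle 𝓘(ℝ, F) ∞ F (fun x : B ↦ TangentSpace 𝓘(ℝ, F) x)]

lemma continuousAt_metricDefect (hf : ContMDiff 𝓘(ℝ, E) 𝓘(ℝ, F) ∞ f) (p : M) :
    ContinuousAt (metricDefect (E := E) (F := F) f p) (extChartAt 𝓘(ℝ, E) p p) := by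
  have h1 : ContinuousAt (metricForm p) (extChartAt 𝓘(ℝ, E) p p) :=
    (differentiableAt_metricForm (mem_extChartAt_target p)).continuousAt
  have hcd := (contDiffAt_coordRep_self hf p).of_le two_le_infty
  have h2 : ContinuousAt (fun x ↦ metricForm (f p) (coordRep (E := E) (F := F) f p x))
      (extChartAt 𝓘(ℝ, E) p p) :=
    ContinuousAt.comp (g := metricForm (f p)) (by
      rw [coordRep_self]
      exact (differentiableAt_metricForm (mem_extChartAt_target (f p))).continuousAt)
      hcd.continuousAt
  have h3 : ContinuousAt (fderiv ℝ (coordRep (E := E) (F := F) f p)) (extChartAt 𝓘(ℝ, E) p p) :=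
    (hcd.fderiv_right (m := 1) (by norm_num)).continuousAt
  refine h1.sub (continuousAt_clm_apply.2 fun z ↦ continuousAt_clm_apply.2 fun z' ↦ ?_)
  exact (h2.clm_apply (h3.clm_apply continuousAt_const)).clm_apply
    (h3.clm_apply continuousAt_const)

/-- The rank of a Riemannian map is locally constant. -/
lemma isLocallyConstant_finrank_rangeAt (hf : IsRiemannianMap (E := E) (F := F) f) :
    IsLocallyConstant fun p ↦ Module.finrank ℝ (rangeAt (E := E) (F := F) f p) := by
  refine (IsLocallyConstant.iff_eventually_eq _).2 fun p ↦ ?_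
  have hp := mem_chart_source E p
  have hb := mem_chart_source F (f p)
  have hcd := (contDiffAt_coordRep_self hf.1 p).of_le two_le_infty
  have h1 := (continuousAt_extChartAt (I := 𝓘(ℝ, E)) p).eventually
    (eventually_finrank_range_le (hcd.fderiv_right (m := 1) (by norm_num)).continuousAt)
  have h2 := (continuousAt_extChartAt (I := 𝓘(ℝ, E)) p).eventually
    (eventually_finrank_range_le (continuousAt_metricDefect hf.1 p))
  filter_upwards [h1, h2, (chartAt E p).open_source.mem_nhds hp,
    hf.1.continuous.continuousAt.eventually_mem ((chartAt F (f p)).open_source.mem_nhds hb)]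
    with q h1 h2 hq hfq
  rw [finrank_range_fderiv_coordRep hf.1 hp hb, finrank_range_fderiv_coordRep hf.1 hq hfq] at h1
  have h3 := finrank_range_metricDefect hf hp hb
  have h4 := finrank_range_metricDefect hf hq hfq
  -- Neither rank can drop near p and their sum is fixed, so neither can jump.
  omega

lemma finrank_rangeAt_eq [PreconnectedSpace M] (hf : IsRiemannianMap (E := E) (F := F) f)
    (p q : M) : Module.finrank ℝ (rangeAt (E := E) (F := F) f p) =
      Module.finrank ℝ (rangeAt (E := E) (F := F) f q) :=
  (isLocallyConstant_finrank_rangeAt hf).apply_eq_of_preconnectedSpace p q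

end Rank

end

theorem theorem3p3
    {E : Type*} [NormedAddCommGroup E] [NormedSpace ℝ E] [FiniteDimensional ℝ E]
    {M : Type*} [TopologicalSpace M] [ChartedSpace E M] [IsManifold 𝓘(ℝ, E) ∞ M]
    [RiemannianBundle (fun x : M ↦ TangentSpace 𝓘(ℝ, E) x)]
    [IsContMDiffRiemannianBundle 𝓘(ℝ, E) ∞ E (fun x : M ↦ TangentSpace 𝓘(ℝ, E) x)]
    {F : Type*} [NormedAddCommGroup F] [NormedSpace ℝ F] [FiniteDimensional ℝ F]
    {B : Type*} [TopologicalSpace B] [ChartedSpace F B] [IsManifold 𝓘(ℝ, F) ∞ B]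
    [RiemannianBundle (fun x : B ↦ TangentSpace 𝓘(ℝ, F) x)]
    [IsContMDiffRiemannianBundle 𝓘(ℝ, F) ∞ F (fun x : B ↦ TangentSpace 𝓘(ℝ, F) x)]
    (S : AlmostContactMetric F B) (α β : B → ℝ) (hS : S.IsTransSasakian α β)
    (f : M → B) (hf : IsRiemannianMap (E := E) (F := F) f)
    (hanti : IsAntiInvariant (E := E) S f) (hξ : HasHorizontalReeb (E := E) S f)
    (h : B → ℝ) (hh : ContMDiff 𝓘(ℝ, F) 𝓘(ℝ, ℝ) ∞ h)
    (hC : IsClairautMap (E := E) (F := F) f (fun b ↦ Real.exp (h b)) ∨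
      IsClairautUmbilical (E := E) (F := F) f h) :
    (∀ p : M, Module.finrank ℝ (rangeAt (E := E) (F := F) f p) = 1 ∨
      IsConstantAlongAt (E := E) S f h p) ∧
    (ConnectedSpace M →
      (∀ p : M, Module.finrank ℝ (rangeAt (E := E) (F := F) f p) = 1) ∨
      (∀ p : M, IsConstantAlongAt (E := E) S f h p)) := by
  have key := finrank_rangeAt_eq_one_or_isConstantAlongAt hS hf hanti hξ hh hC
  refine ⟨key, fun _ ↦ ?_⟩
  -- By constancy of the rank, a single point of rank one decides for all of `M`.
  by_cases h1 : ∃ p, Module.finrank ℝ (rangeAt (E := E) (F := F) f p) = 1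
  · obtain ⟨p, hp⟩ := h1
    exact Or.inl fun q ↦ (finrank_rangeAt_eq hf q p).trans hp
  · exact Or.inr fun p ↦ (key p).resolve_left fun hp ↦ h1 ⟨p, hp⟩
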